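/- **Conventions.** All graphs are finite, simple and undirected; $k\ge 0$ is an integer. A *minimal triangulation* of $G$ is an inclusion-minimal chordal supergraph of $G$ on $V(G)$. A *potential maximal clique* of $G$ is a set $\Omega\subseteq V(G)$ that is a maximal clique of some minimal triangulation of $G$. It is *vital* (for $k$) if $G[\Omega]$ has at least $|\Omega|(|\Omega|-1)/2-k$ edges, and it is a *quasi-clique* (for $k$) if there is $Z\subseteq\Omega$ with $|Z|\le 5\sqrt k$ such that $\Omega\setminus Z$ is a clique of $G$. The pair $(G,k)$ is *non-reducible* if there are no two distinct nonadjacent vertices $u,v$ and chordless $uv$-path $P$ such that every internal vertex $w$ of $P$ satisfies $|(N(u)\cap N(v))\setminus N(w)|\ge\sqrt k$. **Lemma.** (1) There is an algorithm that, given a non-reducible pair $(G,k)$ with $n=|V(G)|$, lists every vital potential maximal clique of $G$ exactly once, and nothing else, in time $n^{O(\sqrt k)}$. Precisely: there are one program and one constant $c$ such that for every non-reducible $(G,k)$ the number of steps is at most $\max(n,2)^{\,c\cdot\max(1,\sqrt k)}$. For $n\ge2$ and $k\ge1$ this is $n^{c\sqrt k}$. Programs are structured programs (assignments, sequencing, conditionals,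 while-loops) over Lisp-style binary trees, with unit cost for each primitive operation, assignment and test, a model polynomially equivalent to Turing machines; $G$ is given by its adjacency matrix, and $k$ in unary. (2) Let $(G,k)$ be non-reducible, and let $\Omega$ be a vital potential maximal clique of $G$ with $|\Omega|\ge 5\sqrt k+3$ that is not a quasi-clique of $G$. Then there is a vertex $w\in V(G)\setminus\Omega$ (so $w$ lies in some connected component of $G\setminus\Omega$) such that $|\Omega\setminus N(w)|\le 5\sqrt k+2$ and $\Omega$ is a quasi-clique of the graph obtained from $G$ by completing $N(w)$ into a clique. -/

import Mathlib

namespace FillIn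

/-! ### Graph notions -/

section Graphs

variable {V : Type*}

/-- A graph is chordal if it has no induced cycle of length at least four. -/
def IsChordal (H : SimpleGraph V) : Prop :=
  ∀ m : ℕ, 4 ≤ m → IsEmpty (SimpleGraph.cycleGraph m ↪g H)

/-- `H` is a triangulation of `G`: a chordal supergraph on the same vertex set. -/
def IsTriangulation (G H : SimpleGraph V) : Prop :=
  G ≤ H ∧ IsChordal H

/-- `H` is an inclusion-minimal triangulation of `G`. -/
def IsMinimalTriangulation (G H : SimpleGraph V) : Prop :=
  Minimal (IsTriangulation G) H

/-- `Ω` is a potential maximal clique of `G`: an inclusion-maximal clique of some minimal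
triangulation of `G`. -/
def IsPMC (G : SimpleGraph V) (Ω : Finset V) : Prop :=
  ∃ H : SimpleGraph V, IsMinimalTriangulation G H ∧ Maximal H.IsClique (Ω : Set V)

/-- A potential maximal clique `Ω` is vital (for the parameter `k`) if `G[Ω]` has at least
`|Ω| (|Ω| - 1) / 2 - k` edges. -/
def IsVitalPMC (G : SimpleGraph V) (k : ℕ) (Ω : Finset V) : Prop :=
  IsPMC G Ω ∧
    ((Ω.card : ℝ) * ((Ω.card : ℝ) - 1)) / 2 - (k : ℝ) ≤
      ((G.induce (Ω : Set V)).edgeSet.ncard : ℝ)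

/-- A potential maximal clique `Ω` is a quasi-clique (for the parameter `k`) if deleting some set
of at most `5 √k` vertices from it leaves a clique. -/
def IsQuasiClique (G : SimpleGraph V) (k : ℕ) (Ω : Finset V) : Prop :=
  IsPMC G Ω ∧ ∃ Z : Finset V, Z ⊆ Ω ∧ (Z.card : ℝ) ≤ 5 * √(k : ℝ) ∧
    G.IsClique ((Ω : Set V) \ (Z : Set V))

/-- The visibility of `X = N(u) ∩ N(v)` from the path `p` is obscured: every internal vertex of `p`
is nonadjacent to at least `√k` vertices of `X`. -/
def IsObscured (G : SimpleGraph V) (k : ℕ) {u v : V} (p : G.Walk u v) : Prop :=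
  ∀ w ∈ p.support, w ≠ u → w ≠ v →
    √(k : ℝ) ≤ ((G.commonNeighbors u v \ G.neighborSet w).ncard : ℝ)

/-- The branching rule does not apply to `(G, k)`: there are no two distinct nonadjacent vertices
`u`, `v` joined by a chordless path from which the visibility of `N(u) ∩ N(v)` is obscured. -/
def NonReducible (G : SimpleGraph V) (k : ℕ) : Prop :=
  ∀ (u v : V) (p : G.Walk u v), u ≠ v → ¬ G.Adj u v → p.IsPath → p.IsChordless →
    ¬ IsObscured G k p

/-- The graph `G_W` obtained from `G` by completing the vertex set `W` into a clique. -/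
def completeOn (G : SimpleGraph V) (W : Set V) : SimpleGraph V where
  Adj a b := G.Adj a b ∨ (a ≠ b ∧ a ∈ W ∧ b ∈ W)
  symm := ⟨fun _ _ h => h.elim (fun h => Or.inl h.symm) fun h => Or.inr ⟨h.1.symm, h.2.2, h.2.1⟩⟩
  loopless := ⟨fun a h => h.elim (fun h => G.loopless.irrefl a h) fun h => h.1 rfl⟩

end Graphs

/-! ### The machine model

Structured imperative programs (the classical `WHILE` language) whose variables hold finite binary
trees, i.e. Lisp-style pointer structures. The primitive operations are reading a variable, the
constant `nil`, `cons`, `hd` and `tl`, and testing a value for being `nil`; each costs one time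
unit, and so does each executed assignment and each evaluated test of a loop or a conditional.
This is one of the standard sequential models, polynomially equivalent to Turing machines. -/

/-- Finite binary trees. -/
inductive Data : Type
  | nil : Data
  | cons : Data → Data → Data

/-- First component (`nil` for `nil`). -/
def Data.hd : Data → Data
  | .nil => .nil
  | .cons a _ => a

/-- Second component (`nil` for `nil`). -/
def Data.tl : Data → Data
  | .nil => .nil
  | .cons _ b => b

/-- Contents of the program variables `0, 1, 2, …`. -/
abbrev Store : Type := ℕ → Data

/-- Expressions. -/
inductive Expr : Type
  | var : ℕ → Expr
  | nil : Expr
  | cons : Expr → Expr → Expr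
  | hd : Expr → Expr
  | tl : Expr → Expr

/-- Value of an expression. -/
def Expr.eval (s : Store) : Expr → Data
  | .var x => s x
  | .nil => .nil
  | .cons e f => .cons (e.eval s) (f.eval s)
  | .hd e => (e.eval s).hd
  | .tl e => (e.eval s).tl

/-- Time needed to evaluate an expression: the number of its operations. -/
def Expr.cost : Expr → ℕ
  | .var _ => 1
  | .nil => 1
  | .cons e f => e.cost + f.cost + 1
  | .hd e => e.cost + 1
  | .tl e => e.cost + 1

/-- Programs. A test succeeds if the value of the expression is not `nil`. -/
inductive Prog : Type
  | assign : ℕ → Expr → Prog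
  | seq : Prog → Prog → Prog
  | ite : Expr → Prog → Prog → Prog
  | loop : Expr → Prog → Prog

/-- `Exec p s t s'`: started in the store `s`, the program `p` halts after exactly `t` time units in
the store `s'`. -/
inductive Exec : Prog → Store → ℕ → Store → Prop
  | assign (x : ℕ) (e : Expr) (s : Store) :
      Exec (.assign x e) s (e.cost + 1) (Function.update s x (e.eval s))
  | seq {p q : Prog} {s s' s'' : Store} {t t' : ℕ} :
      Exec p s t s' → Exec q s' t' s'' → Exec (.seq p q) s (t + t') s''
  | ite_true {e : Expr} {p q : Prog} {s s' : Store} {t : ℕ} :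
      e.eval s ≠ .nil → Exec p s t s' → Exec (.ite e p q) s (e.cost + 1 + t) s'
  | ite_false {e : Expr} {p q : Prog} {s s' : Store} {t : ℕ} :
      e.eval s = .nil → Exec q s t s' → Exec (.ite e p q) s (e.cost + 1 + t) s'
  | loop_done {e : Expr} {p : Prog} {s : Store} :
      e.eval s = .nil → Exec (.loop e p) s (e.cost + 1) s
  | loop_step {e : Expr} {p : Prog} {s s' s'' : Store} {t t' : ℕ} :
      e.eval s ≠ .nil → Exec p s t s' → Exec (.loop e p) s' t' s'' →
        Exec (.loop e p) s (e.cost + 1 + t + t') s''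

/-- The list `[a₁, …, aₘ]` as the tree `cons a₁ (cons a₂ (… nil))`. -/
def Data.ofList : List Data → Data
  | [] => .nil
  | a :: l => .cons a (Data.ofList l)

/-- A natural number in unary, as a list of `nil`s. -/
def Data.ofNat (m : ℕ) : Data := Data.ofList (List.replicate m .nil)

open Classical in
/-- A truth value as a tree: `nil` for false, `cons nil nil` for true. -/
noncomputable def Data.ofProp (P : Prop) : Data := if P then .cons .nil .nil else .nil

/-- A set of vertices as the list of the `n` bits of its characteristic vector. -/
noncomputable def Data.ofVertexSet {n : ℕ} (Ω : Finset (Fin n)) : Data :=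
  Data.ofList (List.ofFn fun i : Fin n => Data.ofProp (i ∈ Ω))

/-- A graph as its adjacency matrix, the list of its `n` rows of `n` bits. -/
noncomputable def Data.ofGraph {n : ℕ} (G : SimpleGraph (Fin n)) : Data :=
  Data.ofList (List.ofFn fun i : Fin n =>
    Data.ofList (List.ofFn fun j : Fin n => Data.ofProp (G.Adj i j)))

/-- Initial store for the instance `(G, k)`: the pair of both is in variable `0`, every other
variable is `nil`. -/
noncomputable def inputStore {n : ℕ} (G : SimpleGraph (Fin n)) (k : ℕ) : Store :=
  Function.update (fun _ => Data.nil) 0 (Data.cons (Data.ofNat k) (Data.ofGraph G))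

/-- On the instance `(G, k)` the program `p` halts after exactly `t` time units, and variable `0`
then holds the list `L` of vertex sets. -/
def Outputs (p : Prog) {n : ℕ} (G : SimpleGraph (Fin n)) (k t : ℕ)
    (L : List (Finset (Fin n))) : Prop :=
  ∃ s : Store, Exec p (inputStore G k) t s ∧ s 0 = Data.ofList (L.map Data.ofVertexSet)

end FillIn

namespace FillIn

/-! ### Connectivity outside a vertex set -/

section Connectivity

variable {V : Type*} {G H : SimpleGraph V} {S T : Set V} {a b c d x : V}

/-! Potential maximal cliques are handled through their local characterization `PMCCond`: no
component of `G - Ω` sees all of `Ω`, and every nonadjacent pair of `Ω` is seen by a common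
component (`isPMC_iff`). This makes membership decidable in polynomial time, and vitality becomes a
bound of `2k` on the ordered nonadjacent pairs inside `Ω` (`isVitalPMC_iff`).

For part (2), few vertices of `Ω` miss at least `√k` others, so if `Ω` is not a quasi-clique there
are nonadjacent `u`, `v` in `Ω`, each missing fewer than `√k`. An induced path between them through
a covering component has, by non-reducibility, an internal vertex `w` missing fewer than `√k` common
neighbours of `u` and `v`. Hence `w` misses few vertices of `Ω` (`IsVitalPMC.exists_vertex`), and
completing `N(w)` turns the rest into a clique while `Ω` stays a potential maximal clique
(`PMCCond.completeOn`).

For part (1), every vital `Ω` other than the whole vertex set is determined in polynomial time by a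
set `Z` of at most `5√k` vertices and at most three further vertices
(`IsVitalPMC.exists_candidate`). If `Ω` is not a quasi-clique, take `Z = Ω \ N(w)`; the rest of `Ω`
is read off as the neighbourhood of one component. If `Ω \ Z` is a clique, it, or the part of it
seen by one component, is a clique minimal separator after deleting vertices of `Z`. A chordal
completion that never crosses clique separators (`lbClosure`) turns such a separator into the common
neighbourhood of two vertices, since a clique seen in full by a component has a common neighbour
there (`LocallySimplicial.exists_universal`). Enumerating all choices gives `n^{O(√k)}` candidates,
which are tested and freed of repetitions.

The running time is obtained compositionally: `Feas` says that one program computes a whole family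
of values in time polynomial in a size parameter, and is closed under the usual constructions. The
size parameter is itself `max(n,2)^(⌊√k⌋+1)`. -/

/-- `d` is reachable from `c` in `G` by a walk avoiding `S` (or `c = d`). -/
def Conn (G : SimpleGraph V) (S : Set V) : V → V → Prop :=
  Relation.ReflTransGen fun x y => G.Adj x y ∧ x ∉ S ∧ y ∉ S

/-- The component of `c` outside `S` has `x` as a neighbour. -/
def Sees (G : SimpleGraph V) (S : Set V) (c x : V) : Prop :=
  ∃ d, Conn G S c d ∧ G.Adj d x

theorem Conn.refl (G : SimpleGraph V) (S : Set V) (c : V) : Conn G S c c :=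
  Relation.ReflTransGen.refl

theorem Conn.trans (h : Conn G S a b) (h' : Conn G S b c) : Conn G S a c :=
  Relation.ReflTransGen.trans h h'

theorem Conn.symm (h : Conn G S a b) : Conn G S b a := by
  induction h with
  | refl => exact Conn.refl _ _ _
  | tail _ h ih => exact Relation.ReflTransGen.head ⟨h.1.symm, h.2.2, h.2.1⟩ ih

theorem Conn.single (h : G.Adj a b) (ha : a ∉ S) (hb : b ∉ S) : Conn G S a b :=
  Relation.ReflTransGen.single ⟨h, ha, hb⟩

theorem Conn.tail (h : Conn G S a b) (h' : G.Adj b c) (hb : b ∉ S) (hc : c ∉ S) : Conn G S a c :=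
  Relation.ReflTransGen.tail h ⟨h', hb, hc⟩

theorem Conn.notMem (h : Conn G S a b) (ha : a ∉ S) : b ∉ S := by
  induction h with
  | refl => exact ha
  | tail _ h _ => exact h.2.2

theorem Conn.mono (h : Conn G S a b) (hG : ∀ x y, x ∉ S → y ∉ S → G.Adj x y → H.Adj x y)
    (hS : ∀ x, x ∉ S → x ∉ T) : Conn H T a b :=
  Relation.ReflTransGen.mono (fun x y h => ⟨hG x y h.2.1 h.2.2 h.1, hS x h.2.1, hS y h.2.2⟩) _ _ h

/-- If every step of `G` from the component of `c` stays there, a connection in `G` outside `S`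
is one in `H` outside `T`. -/
theorem Conn.transfer (h : Conn G S c d)
    (hstep : ∀ x y, Conn G S c x → Conn H T c x → G.Adj x y → x ∉ S → y ∉ S → Conn H T c y) : Conn H T c d := by
  induction h with
  | refl => exact Conn.refl _ _ _
  | tail hcx h ih => exact hstep _ _ hcx ih h.1 h.2.1 h.2.2

theorem Sees.of_conn (h : Sees G S b x) (h' : Conn G S a b) : Sees G S a x :=
  let ⟨d, hd, hx⟩ := h
  ⟨d, h'.trans hd, hx⟩

/-- A walk from a neighbour of `v` to a vertex outside the closed neighbourhood of `v` has a last
vertex in the neighbourhood. -/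
theorem Conn.exists_last (h : Conn G S a x) (hav : G.Adj v a)
    (hxv : x ≠ v) (hx : ¬ G.Adj v x) :
    ∃ p e, Conn G S a p ∧ G.Adj v p ∧ G.Adj p e ∧ e ∉ insert v (G.neighborSet v) ∧
      Conn G (insert v (G.neighborSet v)) e x := by
  -- Induction from the far end `x`: either the remaining walk already avoids `N[v]`, or its last
  -- exit from `N(v)` has been found.
  have key : ∀ b, Conn G S a b → Conn G S b x → 
      Conn G (insert v (G.neighborSet v)) b x ∧ b ∉ insert v (G.neighborSet v) ∨
      ∃ p e, Conn G S a p ∧ G.Adj v p ∧ G.Adj p e ∧ e ∉ insert v (G.neighborSet v) ∧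
        Conn G (insert v (G.neighborSet v)) e x := by
    intro b hab hbx
    induction hbx using Relation.ReflTransGen.head_induction_on with
    | refl => exact Or.inl ⟨Conn.refl _ _ _, by simp [hxv, hx]⟩
    | head hbc hcx ih =>
      rename_i b c
      rcases ih (hab.tail hbc.1 hbc.2.1 hbc.2.2) with ⟨h1, h2⟩ | h
      · by_cases hb : b ∈ insert v (G.neighborSet v)
        · rcases hb with rfl | hb
          · exact absurd (Set.mem_insert_of_mem _ hbc.1) h2
          · exact Or.inr ⟨b, c, hab, hb, hbc.1, h2, h1⟩
        · exact Or.inl ⟨(Conn.single hbc.1 hb h2).trans h1, hb⟩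
      · exact Or.inr h
  rcases key a (Conn.refl _ _ _) h with ⟨_, h⟩ | h
  · exact absurd (Set.mem_insert_of_mem _ hav) h
  · exact h

theorem Sees.exists_last_of_adj {v w : V} (h : Sees G S w x) (hvw : G.Adj v w) (hxv : x ≠ v)
    (hx : ¬ G.Adj v x) :
    ∃ p e, Conn G S w p ∧ G.Adj v p ∧ G.Adj p e ∧ e ∉ insert v (G.neighborSet v) ∧
      Conn G (insert v (G.neighborSet v)) e x := by
  obtain ⟨d, hwd, hdx⟩ := h
  have hxN : x ∉ insert v (G.neighborSet v) := by simp [hxv, hx]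
  by_cases hd : G.Adj v d
  · exact ⟨d, x, hwd, hd, hdx, hxN, Conn.refl _ _ _⟩
  have hdv : d ≠ v := by rintro rfl; exact hx hdx
  obtain ⟨p, e, hwp, hvp, hpe, he, hed⟩ := Conn.exists_last hwd hvw hdv hd
  exact ⟨p, e, hwp, hvp, hpe, he, hed.tail hdx (hed.notMem he) hxN⟩

theorem Sees.exists_last {v : V} (h : Sees G S v x) (hxv : x ≠ v) (hx : ¬ G.Adj v x) :
    ∃ p e, Conn G S v p ∧ G.Adj v p ∧ G.Adj p e ∧ e ∉ insert v (G.neighborSet v) ∧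
      Conn G (insert v (G.neighborSet v)) e x := by
  obtain ⟨d, hvd, hdx⟩ := h
  rcases Relation.ReflTransGen.cases_head hvd with rfl | ⟨w, h, hwd⟩
  · exact absurd hdx hx
  · obtain ⟨p, e, hwp, hp⟩ := Sees.exists_last_of_adj ⟨d, hwd, hdx⟩ h.1 hxv hx
    exact ⟨p, e, (Conn.single h.1 h.2.1 h.2.2).trans hwp, hp⟩

/-- Two neighbours of a connected set are joined by a path through it without shortcuts. -/
theorem exists_geodesic {p q : V} (hpc : G.Adj p c) (hcd : Conn G S c d) (hdq : G.Adj d q)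
    (hc : c ∉ S) (hpq : ¬ G.Adj p q) (hne : p ≠ q) :
    ∃ w : G.Walk p q, w.IsPath ∧ (∀ x ∈ w.support, x ≠ p → x ≠ q → x ∉ S) ∧
      (∀ i j, i < j → j ≤ w.length → G.Adj (w.getVert i) (w.getVert j) → j = i + 1) ∧
      2 ≤ w.length := by
  classical
  -- A walk of minimal length among those whose interior avoids `S` has no shortcuts.
  let P : ℕ → Prop := fun l =>
    ∃ w : G.Walk p q, w.length = l ∧ ∀ x ∈ w.support, x ≠ p → x ≠ q → x ∉ S
  have hex : ∃ l, P l := by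
    have : ∃ w : G.Walk p d, ∀ x ∈ w.support, x ≠ p → x ∉ S := by
      clear hdq
      induction hcd with
      | refl => exact ⟨.cons hpc .nil, by simp; grind⟩
      | tail _ h ih =>
        obtain ⟨w, hw⟩ := ih
        refine ⟨w.concat h.1, ?_⟩
        intro x hx
        rw [SimpleGraph.Walk.support_concat] at hx
        simp only [List.mem_append, List.mem_singleton] at hx
        grind
    obtain ⟨w, hw⟩ := this
    refine ⟨_, w.concat hdq, rfl, ?_⟩
    intro x hx
    rw [SimpleGraph.Walk.support_concat] at hx
    simp only [List.mem_append, List.mem_singleton] at hx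
    grind
  obtain ⟨w0, hl0, hw0⟩ := Nat.find_spec hex
  have hmin : ∀ w : G.Walk p q, (∀ x ∈ w.support, x ≠ p → x ≠ q → x ∉ S) →
      Nat.find hex ≤ w.length := fun w hw => Nat.find_min' hex ⟨w, rfl, hw⟩
  have hs : ∀ x ∈ w0.bypass.support, x ≠ p → x ≠ q → x ∉ S := fun x hx =>
    hw0 x (w0.support_bypass_subset_support hx)
  have hl : w0.bypass.length = Nat.find hex :=
    le_antisymm (w0.length_bypass_le_length.trans hl0.le) (hmin _ hs)
  refine ⟨w0.bypass, w0.bypass_isPath, hs, ?_, ?_⟩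
  · intro i j hij hj hadj
    -- Replacing the segment from `i` to `j` by the edge gives length `i + 1 + (length - j)`, which
    -- minimality forces to be no shorter.
    have h1 := hmin ((w0.bypass.take i).append (.cons hadj (w0.bypass.drop j))) (by
      intro x hx
      apply hs
      rw [SimpleGraph.Walk.mem_support_append_iff] at hx
      rcases hx with hx | hx
      · rw [SimpleGraph.Walk.support_take] at hx
        exact List.mem_of_mem_take hx
      · rw [SimpleGraph.Walk.support_cons, List.mem_cons] at hx
        rcases hx with rfl | hx
        · exact SimpleGraph.Walk.getVert_mem_support _ _
        · rw [SimpleGraph.Walk.drop_support_eq_support_drop_min] at hx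
          exact List.mem_of_mem_drop hx)
    rw [SimpleGraph.Walk.length_append, SimpleGraph.Walk.length_cons,
      SimpleGraph.Walk.take_length, SimpleGraph.Walk.drop_length] at h1
    omega
  · by_contra hlt
    generalize w0.bypass = w at hlt
    match w, hlt with
    | .nil, _ => exact hne rfl
    | .cons h .nil, _ => exact hpq h
    | .cons _ (.cons _ _), h => simp at h

end Connectivity

/-! ### Chordal graphs -/

section Chordal

variable {V : Type*} {G H : SimpleGraph V}

/-- Every vertex is locally simplicial: two neighbours of `v` that are joined outside the closed
neighbourhood of `v` are adjacent. -/
def LocallySimplicial (H : SimpleGraph V) : Prop :=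
  ∀ v p q c d, H.Adj v p → H.Adj v q → p ≠ q →
    c ∉ insert v (H.neighborSet v) → H.Adj p c →
    Conn H (insert v (H.neighborSet v)) c d → H.Adj d q → H.Adj p q

/-- Every nonempty vertex set has a simplicial vertex. -/
def HasElimination (H : SimpleGraph V) : Prop :=
  ∀ U : Finset V, U.Nonempty → ∃ s ∈ U, ∀ a ∈ U, ∀ b ∈ U,
    H.Adj s a → H.Adj s b → a ≠ b → H.Adj a b

/-- If `p` and `q` were nonadjacent, a shortest path between them through the component outside
`N[v]` would close up with `v` to an induced cycle. The path has length at least 2, so the cycle has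
length at least 4. -/
theorem IsChordal.locallySimplicial (hH : IsChordal H) : LocallySimplicial H := by
  intro v p q c d hvp hvq hpq hc hpc hcd hdq
  by_contra hadj
  obtain ⟨w, hw, hS, hgeo, hlen⟩ := exists_geodesic hpc hcd hdq hc hadj hpq
  have hinj : ∀ i j, i ≤ w.length → j ≤ w.length → w.getVert i = w.getVert j → i = j :=
    fun i j hi hj h => hw.getVert_injOn hi hj h
  have hint : ∀ i, 0 < i → i < w.length → w.getVert i ∉ insert v (H.neighborSet v) := by
    intro i h0 hi
    refine hS _ (SimpleGraph.Walk.getVert_mem_support _ _) ?_ ?_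
    · intro h
      have := hinj i 0 (by omega) (by omega) (by simpa using h)
      omega
    · intro h
      have := hinj i w.length (by omega) le_rfl (by simpa using h)
      omega
  have hv : ∀ i, i ≤ w.length → w.getVert i ≠ v := by
    intro i hi h
    rcases Nat.eq_zero_or_pos i with rfl | h0
    · rw [SimpleGraph.Walk.getVert_zero] at h
      exact hvp.ne h.symm
    rcases hi.lt_or_eq with hi | rfl
    · exact hint i h0 hi (by simp [h])
    · rw [SimpleGraph.Walk.getVert_length] at h
      exact hvq.ne h.symm
  have hvadj : ∀ i, i ≤ w.length → (H.Adj v (w.getVert i) ↔ i = 0 ∨ i = w.length) := by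
    intro i hi
    constructor
    · intro h
      by_contra hne
      push Not at hne
      exact hint i (by omega) (by omega) (Set.mem_insert_of_mem _ h)
    · rintro (rfl | rfl)
      · simpa using hvp
      · simpa using hvq
  have hpath : ∀ i j, i ≤ w.length → j ≤ w.length →
      (H.Adj (w.getVert i) (w.getVert j) ↔ j = i + 1 ∨ i = j + 1) := by
    intro i j hi hj
    constructor
    · intro h
      rcases lt_trichotomy i j with hij | rfl | hij
      · exact Or.inl (hgeo i j hij hj h)
      · exact absurd h (H.loopless.irrefl _)
      · exact Or.inr (hgeo j i hij hi h.symm)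
    · rintro (rfl | rfl)
      · exact w.adj_getVert_succ hj
      · exact (w.adj_getVert_succ hi).symm
  -- The path fills the indices up to `w.length`; the one remaining index is `v`.
  let f : Fin (w.length + 2) → V := fun i => if (i : ℕ) ≤ w.length then w.getVert i else v
  have hf : Function.Injective f := by
    intro i j h
    simp only [f] at h
    apply Fin.ext
    split_ifs at h with h1 h2 h2
    · exact hinj _ _ h1 h2 h
    · exact absurd h (hv _ h1)
    · exact absurd h.symm (hv _ h2)
    · omega
  refine (hH (w.length + 2) (by omega)).false ⟨⟨f, hf⟩, ?_⟩
  intro i j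
  simp only [Function.Embedding.coeFn_mk, f]
  have hi := i.2
  have hj := j.2
  rw [SimpleGraph.cycleGraph_adj']
  have hsub : ∀ i j : Fin (w.length + 2), (i - j).val = 1 ↔
      (i.val = j.val + 1 ∨ (i.val = 0 ∧ j.val = w.length + 1)) := by
    intro i j
    have hi := i.2
    have hj := j.2
    rcases le_or_gt j i with h | h
    · rw [Fin.sub_val_of_le h]
      have : j.val ≤ i.val := h
      omega
    · rw [Fin.coe_sub_iff_lt.2 h]
      have : i.val < j.val := h
      omega
  rw [hsub, hsub]
  split_ifs with h1 h2 h2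
  · rw [hpath _ _ h1 h2]; omega
  · rw [SimpleGraph.adj_comm, hvadj _ h1]; omega
  · rw [hvadj _ h2]; omega
  · simp only [SimpleGraph.irrefl, false_iff]; omega

/-- A simplicial vertex of an induced cycle would make its two cycle neighbours adjacent. Their
indices differ by 2, and neither 1 nor 3 vanishes modulo a length of at least 4. -/
theorem HasElimination.isChordal (hH : HasElimination H) : IsChordal H := by
  classical
  intro m hm
  refine ⟨fun φ => ?_⟩
  obtain ⟨n, rfl⟩ : ∃ n, m = n + 2 := ⟨m - 2, by omega⟩
  obtain ⟨s, hs, hsimp⟩ := hH (Finset.univ.map φ.toEmbedding) ⟨φ 0, by simp⟩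
  obtain ⟨i, -, rfl⟩ := Finset.mem_map.1 hs
  have h := hsimp (φ (i + 1)) (by simp) (φ (i - 1)) (by simp)
    (φ.map_rel_iff.2 (by rw [SimpleGraph.cycleGraph_adj]; right; abel))
    (φ.map_rel_iff.2 (by rw [SimpleGraph.cycleGraph_adj]; left; abel))
  have h1 : (1 : Fin (n + 2)).val = 1 := by simp
  have h2 : ((1 : Fin (n + 2)) + 1).val = 2 := by
    rw [Fin.val_add, h1, Nat.mod_eq_of_lt (by omega)]
  have h3 : ((1 : Fin (n + 2)) + 1 + 1).val = 3 := by
    rw [Fin.val_add, h1, h2, Nat.mod_eq_of_lt (by omega)]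
  have hadj := h (by
    intro he
    have he := φ.injective he
    have : (1 : Fin (n + 2)) + 1 = 0 := by
      have := sub_eq_zero.2 he
      rw [← this]; abel
    rw [this] at h2
    simp at h2)
  have hadj := φ.map_rel_iff.1 hadj
  rw [SimpleGraph.cycleGraph_adj] at hadj
  rcases hadj with hadj | hadj
  · have : (1 : Fin (n + 2)) + 1 = 1 := by 
      have h4 : (1 : Fin (n + 2)) + 1 = i + 1 - (i - 1) := by abel
      rw [h4, hadj]
    rw [this] at h2
    omega
  · have : (1 : Fin (n + 2)) + 1 + 1 = 0 := by
      have := sub_eq_zero.2 hadj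
      rw [← neg_eq_zero, ← this]; abel
    rw [this] at h3
    simp at h3

end Chordal

/-! ### Simplicial vertices and universal vertices in locally simplicial graphs -/

section Simplicial

variable {V : Type*} {G H : SimpleGraph V}

/-- The neighbours of `s` in `U` are pairwise adjacent. -/
def SimplicialIn (H : SimpleGraph V) (U : Finset V) (s : V) : Prop :=
  ∀ a ∈ U, ∀ b ∈ U, H.Adj s a → H.Adj s b → a ≠ b → H.Adj a b

/-- Dirac's argument by induction on `U`. A component `C` of `U - N[v]` has a neighbourhood `S`
inside `N(v)`, which is a clique by local simpliciality. A vertex of `C` simplicial in the smaller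
set `C ∪ S` is simplicial in `U`, because all its neighbours in `U` lie in `C ∪ S`. -/
theorem LocallySimplicial.exists_simplicialIn_not_adj (hH : LocallySimplicial H) (U : Finset V) :
    ∀ v, (∃ c ∈ U, c ≠ v ∧ ¬ H.Adj v c) → v ∈ U →
      ∃ s ∈ U, s ≠ v ∧ ¬ H.Adj v s ∧ SimplicialIn H U s := by
  classical
  induction U using Finset.strongInduction with
  | H U ih =>
  rintro v ⟨c, hcU, hcv, hvc⟩ hvU
  -- Vertices outside `U` are forbidden too, so that connectivity outside `T` is connectivity inside
  -- `U - N[v]`.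
  set T : Set V := {x | x = v ∨ H.Adj v x ∨ x ∉ U} with hT
  have hcT : c ∉ T := by simp [hT, hcv, hvc, hcU]
  let C := U.filter (Conn H T c)
  let S := U.filter fun y => ¬ Conn H T c y ∧ Sees H T c y
  have hCT : ∀ x, Conn H T c x → x ≠ v ∧ ¬ H.Adj v x ∧ x ∈ U := by
    intro x hx
    have := hx.notMem hcT
    simpa [hT, not_or] using this
  have hSv : ∀ y ∈ S, H.Adj v y := by
    intro y hy
    obtain ⟨hyU, hy1, d, hd, hdy⟩ := Finset.mem_filter.1 hy
    by_contra hn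
    refine hy1 (hd.tail hdy (hd.notMem hcT) ?_)
    simp only [hT, Set.mem_ofPred_eq, not_or, not_not]
    refine ⟨?_, hn, hyU⟩
    rintro rfl
    exact (hCT d hd).2.1 hdy.symm
  have hSclique : ∀ y ∈ S, ∀ y' ∈ S, y ≠ y' → H.Adj y y' := by
    intro y hy y' hy' hne
    obtain ⟨-, -, d, hd, hdy⟩ := Finset.mem_filter.1 hy
    obtain ⟨-, -, d', hd', hdy'⟩ := Finset.mem_filter.1 hy'
    refine hH v y y' d d' (hSv y hy) (hSv y' hy') hne ?_ hdy.symm ?_ hdy'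
    · have := hCT d hd
      simp [this.1, this.2.1]
    · refine (hd.symm.trans hd').mono (fun _ _ _ _ h => h) ?_
      intro x hx
      simp only [hT, Set.mem_ofPred_eq, not_or] at hx
      simp [hx.1, hx.2.1]
  have hsub : C ∪ S ⊂ U := by
    refine Finset.ssubset_iff_of_subset (Finset.union_subset (Finset.filter_subset _ _)
      (Finset.filter_subset _ _)) |>.2 ⟨v, hvU, ?_⟩
    rw [Finset.mem_union, not_or]
    exact ⟨fun h => (hCT v (Finset.mem_filter.1 h).2).1 rfl, fun h => H.loopless.irrefl _ (hSv v h)⟩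
  have hcC : c ∈ C := Finset.mem_filter.2 ⟨hcU, Conn.refl _ _ _⟩
  -- Induction is applied at a vertex `u` with a nonneighbour in `C ∪ S`. Choosing `u` in `S` if
  -- possible, the resulting `s` is not in `S`: either `S` is a clique containing `u`, or every
  -- vertex of `S` is adjacent to all others. Without such a `u`, the set `C ∪ S` is a clique.
  obtain ⟨s, hsC, hs⟩ : ∃ s ∈ C, SimplicialIn H (C ∪ S) s := by
    by_cases h1 : ∃ u ∈ S, ∃ e ∈ C ∪ S, e ≠ u ∧ ¬ H.Adj u e
    · obtain ⟨u, hu, he⟩ := h1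
      obtain ⟨s, hs, hsu, hsadj, hsimp⟩ := ih _ hsub u he (Finset.mem_union_right _ hu)
      refine ⟨s, (Finset.mem_union.1 hs).resolve_right fun h => ?_, hsimp⟩
      exact hsadj (hSclique u hu s h hsu.symm)
    · push Not at h1
      by_cases h2 : ∃ u ∈ C, ∃ e ∈ C ∪ S, e ≠ u ∧ ¬ H.Adj u e
      · obtain ⟨u, hu, he⟩ := h2
        obtain ⟨s, hs, hsu, hsadj, hsimp⟩ := ih _ hsub u he (Finset.mem_union_left _ hu)
        refine ⟨s, (Finset.mem_union.1 hs).resolve_right fun h => ?_, hsimp⟩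
        exact hsadj (h1 s h u (Finset.mem_union_left _ hu) hsu.symm).symm
      · push Not at h2
        refine ⟨c, hcC, fun a ha b hb _ _ hab => ?_⟩
        rcases Finset.mem_union.1 ha with ha | ha
        · exact h2 a ha b hb hab.symm
        · exact h1 a ha b hb hab.symm
  have hsc := (Finset.mem_filter.1 hsC).2
  obtain ⟨h1, h2, h3⟩ := hCT s hsc
  have hmem : ∀ a ∈ U, H.Adj s a → a ∈ C ∪ S := by
    intro a ha hsa
    by_cases hca : Conn H T c a
    · exact Finset.mem_union_left _ (Finset.mem_filter.2 ⟨ha, hca⟩)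
    · exact Finset.mem_union_right _ (Finset.mem_filter.2 ⟨ha, hca, s, hsc, hsa⟩)
  exact ⟨s, h3, h1, h2, fun a ha b hb hsa hsb hab =>
    hs a (hmem a ha hsa) b (hmem b hb hsb) hsa hsb hab⟩

/-- Outside a proper sub-clique of `U` there is a simplicial vertex of `U`. -/
theorem LocallySimplicial.exists_simplicialIn (hH : LocallySimplicial H) {U : Finset V}
    {K : Set V} (hK : H.IsClique K) {c : V} (hc : c ∈ U) (hcK : c ∉ K) (hKU : K ⊆ U) :
    ∃ s ∈ U, s ∉ K ∧ SimplicialIn H U s := by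
  by_cases h1 : ∃ v ∈ K, ∃ e ∈ U, e ≠ v ∧ ¬ H.Adj v e
  · obtain ⟨v, hv, he⟩ := h1
    obtain ⟨s, hs, hsv, hadj, hsimp⟩ := hH.exists_simplicialIn_not_adj U v he (hKU hv)
    exact ⟨s, hs, fun h => hadj (hK hv h hsv.symm), hsimp⟩
  · push Not at h1
    by_cases h2 : ∃ v ∈ U, ∃ e ∈ U, e ≠ v ∧ ¬ H.Adj v e
    · obtain ⟨v, hv, he⟩ := h2
      obtain ⟨s, hs, hsv, hadj, hsimp⟩ := hH.exists_simplicialIn_not_adj U v he hv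
      exact ⟨s, hs, fun h => hadj (h1 s h v hv hsv.symm).symm, hsimp⟩
    · push Not at h2
      exact ⟨c, hc, hcK, fun a ha b hb _ _ hab => h2 a ha b hb hab.symm⟩

/-- A clique all of whose vertices are seen by a component has a common neighbour there. -/
theorem LocallySimplicial.exists_universal [Finite V] (hH : LocallySimplicial H) {X : Set V}
    (hX : H.IsClique X) {c : V} (hc : c ∉ X) (hsees : ∀ x ∈ X, Sees H X c x) :
    ∃ v, Conn H X c v ∧ ∀ x ∈ X, H.Adj v x := by
  classical
  have key : ∀ K : Set V, K.Finite → K ⊆ X → ∃ v, Conn H X c v ∧ ∀ x ∈ K, H.Adj v x := by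
    intro K hKfin
    induction K, hKfin using Set.Finite.induction_on with
    | empty => exact fun _ => ⟨c, Conn.refl _ _ _, by simp⟩
    | @insert x K hxK _ ih =>
      intro hKX
      have hxX : x ∈ X := hKX (Set.mem_insert _ _)
      have hKX : K ⊆ X := (Set.subset_insert _ _).trans hKX
      -- Descent on the size of the component of `x` outside `N[v]`, keeping `v` in the component of
      -- `c` and adjacent to all of `K`; it stops once `v` is adjacent to `x`.
      let Q : V → Set V := fun v => {y | y ∉ insert v (H.neighborSet v) ∧ Conn H (insert v (H.neighborSet v)) x y}
      have main : ∀ m v, (Q v).ncard = m → Conn H X c v → (∀ k ∈ K, H.Adj v k) →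
          ∃ v, Conn H X c v ∧ ∀ k ∈ insert x K, H.Adj v k := by
        intro m
        induction m using Nat.strong_induction_on with
        | _ m ihm =>
        intro v hm hcv hvK
        by_cases hvx : H.Adj v x
        · exact ⟨v, hcv, by simpa [hvx] using hvK⟩
        have hvX : v ∉ X := hcv.notMem hc
        have hxv : x ≠ v := fun h => hvX (h ▸ hxX)
        have hxN : x ∉ insert v (H.neighborSet v) := by simp [hxv, hvx]
        obtain ⟨p, e, hvp, hadj, hpe, he, hex⟩ :=
          ((hsees x hxX).of_conn hcv.symm).exists_last hxv hvx
        replace hvp := hcv.trans hvp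
        have hpX : p ∉ X := hvp.notMem hc
        -- The replacement `p` is the last neighbour of `v` on a way to `x`. It touches the
        -- component of `x` outside `N[v]`, so by local simpliciality it is adjacent to every other
        -- neighbour of `v` attached there. This includes `K`, whose members are adjacent to both
        -- `v` and `x`.
        have hclique : ∀ y, H.Adj v y → (∃ d, Conn H (insert v (H.neighborSet v)) x d ∧ H.Adj d y) →
            y ≠ p → H.Adj p y := by
          rintro y hvy ⟨d, hd, hdy⟩ hne
          exact hH v p y e d hadj hvy hne.symm he hpe (hex.trans hd) hdy
        refine ihm _ ?_ p rfl hvp ?_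
        · rw [← hm]
          have hQe : e ∈ Q v := ⟨he, hex.symm⟩
          refine Set.ncard_lt_ncard (Set.ssubset_iff_of_subset ?_ |>.2 ⟨e, hQe, ?_⟩) (Set.toFinite _)
          · rintro y ⟨-, hy⟩
            -- The new component cannot leave the old one: the exit vertex would be a neighbour of
            -- `v` attached to it, hence equal or adjacent to `p`. It is strictly smaller, because
            -- it loses `e`.
            suffices hy : Conn H (insert v (H.neighborSet v)) x y from ⟨hy.notMem hxN, hy⟩
            refine Conn.transfer hy fun a b _ ha hab haN hbN => ?_
            refine ha.tail hab (ha.notMem hxN) ?_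
            rintro (rfl | hb)
            · exact hbN (Set.mem_insert_of_mem _ hadj.symm)
            · refine hbN ?_
              by_cases hbp : b = p
              · exact Or.inl hbp
              · exact Or.inr (hclique b hb ⟨a, ha, hab⟩ hbp)
          · exact fun h => h.1 (Set.mem_insert_of_mem _ hpe)
        · intro k hk
          refine hclique k (hvK k hk) ⟨x, Conn.refl _ _ _, hX hxX (hKX hk) ?_⟩ ?_
          · rintro rfl; exact hxK hk
          · rintro rfl; exact hpX (hKX hk)
      obtain ⟨v, hv, hvK⟩ := ih hKX
      exact main _ v rfl hv hvK
  exact key X (Set.toFinite _) subset_rfl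

end Simplicial

/-! ### The local characterization of potential maximal cliques -/

section PMC

variable {V : Type*} {G H : SimpleGraph V}

/-- Two vertices of a separator that are both seen from two sides are adjacent in a chordal
graph. -/
theorem LocallySimplicial.adj_of_sees (hH : LocallySimplicial H) {S : Set V} {a b x y : V}
    (ha : a ∉ S) (hb : b ∉ S) (hxy : x ≠ y)
    (hab : ¬ Conn H S a b) (hax : Sees H S a x) (hay : Sees H S a y) (hbx : Sees H S b x)
    (hby : Sees H S b y) : H.Adj x y := by
  by_contra hadj
  -- On each side, take the last neighbour of `x` on a way to `y`. Both attach to the component of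
  -- `y` outside `N[x]`, so they are adjacent, which joins the two sides.
  have side : ∀ c, c ∉ S → Sees H S c x → Sees H S c y →
      ∃ p e, Conn H S c p ∧ H.Adj x p ∧ H.Adj p e ∧ e ∉ insert x (H.neighborSet x) ∧
        Conn H (insert x (H.neighborSet x)) e y := by
    rintro c hc ⟨d, hcd, hdx⟩ hcy
    obtain ⟨p, e, hp, h⟩ := (hcy.of_conn hcd.symm).exists_last_of_adj hdx.symm hxy.symm hadj
    exact ⟨p, e, hcd.trans hp, h⟩
  obtain ⟨p, e, hap, hxp, hpe, he, hey⟩ := side a ha hax hay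
  obtain ⟨q, f, hbq, hxq, hqf, hf, hfy⟩ := side b hb hbx hby
  have hpq : p ≠ q := by
    rintro rfl
    exact hab (hap.trans hbq.symm)
  have hpq' := hH x p q e f hxp hxq hpq he hpe (hey.trans hfy.symm) hqf.symm
  exact hab ((hap.tail hpq' (hap.notMem ha) (hbq.notMem hb)).trans hbq.symm)

/-- The characterization of potential maximal cliques: no component outside `Ω` is full, and
nonadjacent pairs of vertices of `Ω` are covered by components. -/
def PMCCond (G : SimpleGraph V) (Ω : Set V) : Prop :=
  (∀ c, c ∉ Ω → ∃ x ∈ Ω, ¬ Sees G Ω c x) ∧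
    ∀ x ∈ Ω, ∀ y ∈ Ω, x ≠ y → ¬ G.Adj x y → ∃ c, c ∉ Ω ∧ Sees G Ω c x ∧ Sees G Ω c y

/-- `x` lies in the component of `c` outside `Ω` or is a neighbour of it in `Ω`. -/
def InBag (G : SimpleGraph V) (Ω : Set V) (c x : V) : Prop :=
  Conn G Ω c x ∨ (x ∈ Ω ∧ Sees G Ω c x)

theorem InBag.of_conn {Ω : Set V} {a b x : V} (h : InBag G Ω b x) (hab : Conn G Ω a b) :
    InBag G Ω a x :=
  h.imp hab.trans fun h => ⟨h.1, h.2.of_conn hab⟩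

theorem InBag.conn {Ω : Set V} {c x : V} (h : InBag G Ω c x) (hx : x ∉ Ω) : Conn G Ω c x :=
  h.resolve_right fun h => hx h.1

theorem inBag_of_adj {Ω : Set V} {x y : V} (h : G.Adj x y) (hx : x ∉ Ω) : InBag G Ω x y := by
  by_cases hy : y ∈ Ω
  · exact Or.inr ⟨hy, x, Conn.refl _ _ _, h⟩
  · exact Or.inl (Conn.single h hx hy)

/-- The graph in which `Ω` and the closed neighbourhoods of the components outside `Ω` are
cliques. -/
def bagGraph (G : SimpleGraph V) (Ω : Set V) : SimpleGraph V where
  Adj x y := x ≠ y ∧ ((x ∈ Ω ∧ y ∈ Ω) ∨ ∃ c, c ∉ Ω ∧ InBag G Ω c x ∧ InBag G Ω c y)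
  symm := ⟨fun _ _ h => ⟨h.1.symm, h.2.imp (fun h => ⟨h.2, h.1⟩)
    fun ⟨c, h⟩ => ⟨c, h.1, h.2.2, h.2.1⟩⟩⟩
  loopless := ⟨fun _ h => h.1 rfl⟩

theorem inBag_of_bagGraph_adj {Ω : Set V} {x y : V} (h : (bagGraph G Ω).Adj x y) (hx : x ∉ Ω) :
    InBag G Ω x y := by
  rcases h.2 with h | ⟨c, hc, hcx, hcy⟩
  · exact absurd h.1 hx
  · exact hcy.of_conn (hcx.conn hx).symm

theorem le_bagGraph (G : SimpleGraph V) (Ω : Set V) : G ≤ bagGraph G Ω := by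
  intro x y h
  refine ⟨h.ne, ?_⟩
  by_cases hx : x ∈ Ω
  · by_cases hy : y ∈ Ω
    · exact Or.inl ⟨hx, hy⟩
    · exact Or.inr ⟨y, hy, inBag_of_adj h.symm hy, Or.inl (Conn.refl _ _ _)⟩
  · exact Or.inr ⟨x, hx, Or.inl (Conn.refl _ _ _), inBag_of_adj h hx⟩

/-- A vertex outside `Ω` has all its neighbours in a single bag, which is a clique, so it is
simplicial in any set; a set inside `Ω` is itself a clique. -/
theorem bagGraph_isChordal (G : SimpleGraph V) (Ω : Set V) : IsChordal (bagGraph G Ω) := by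
  refine HasElimination.isChordal fun U ⟨u, hu⟩ => ?_
  by_cases hU : ∃ c ∈ U, c ∉ Ω
  · obtain ⟨c, hcU, hc⟩ := hU
    exact ⟨c, hcU, fun a _ b _ ha hb hab =>
      ⟨hab, Or.inr ⟨c, hc, inBag_of_bagGraph_adj ha hc, inBag_of_bagGraph_adj hb hc⟩⟩⟩
  · push Not at hU
    exact ⟨u, hu, fun a ha b hb _ _ hab => ⟨hab, Or.inl ⟨hU a ha, hU b hb⟩⟩⟩

/-- Take a minimal triangulation `H` below `bagGraph G Ω`. No vertex outside `Ω` can be added, since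
its bag misses a vertex of `Ω`. If `x`, `y` in `Ω` were nonadjacent in `H`, a component seeing both
and a vertex `x₀` of `Ω` that it does not see would lie on different sides of its neighbourhood `S`,
both seeing `x` and `y`; `LocallySimplicial.adj_of_sees` then gives the edge. -/
theorem PMCCond.isPMC [Finite V] {Ω : Finset V} (h : PMCCond G (Ω : Set V)) : IsPMC G Ω := by
  obtain ⟨H, hle, hmin⟩ := exists_minimal_le_of_wellFoundedLT (IsTriangulation G)
    (bagGraph G Ω) ⟨le_bagGraph G Ω, bagGraph_isChordal G Ω⟩
  obtain ⟨hGH, hH⟩ := hmin.prop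
  have hLS := hH.locallySimplicial
  refine ⟨H, hmin, ?_, ?_⟩
  · intro x hx y hy hxy
    by_contra hadj
    obtain ⟨c, hc, hcx, hcy⟩ := h.2 x hx y hy hxy fun h => hadj (hGH h)
    obtain ⟨x₀, hx₀, hcx₀⟩ := h.1 c hc
    let S : Set V := {s | s ∈ Ω ∧ Sees G Ω c s}
    have hSΩ : ∀ v : V, v ∉ (Ω : Set V) → v ∉ S := fun v hv h => hv h.1
    have hmono : ∀ a b, Conn G Ω a b → Conn H S a b := fun a b h =>
      h.mono (fun _ _ _ _ h => hGH h) hSΩ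
    have hcS : ∀ s, Sees G Ω c s → Sees H S c s := fun s ⟨d, hd, hds⟩ =>
      ⟨d, hmono _ _ hd, hGH hds⟩
    -- A nonadjacent pair `x₀`, `s` is covered by some component of `G - Ω`, through which `x₀`
    -- reaches `s` without meeting `S`.
    have hx₀S : ∀ s ∈ S, Sees H S x₀ s := by
      intro s hs
      have hne : x₀ ≠ s := by
        rintro rfl
        exact hcx₀ hs.2
      by_cases hadj : G.Adj x₀ s
      · exact ⟨x₀, Conn.refl _ _ _, hGH hadj⟩
      · obtain ⟨e, he, ⟨d, hd, hdx⟩, ⟨d', hd', hdx'⟩⟩ := h.2 x₀ hx₀ s hs.1 hne hadj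
        exact ⟨d', (Conn.single (hGH hdx.symm) (fun h => hcx₀ h.2)
          (hSΩ _ (hd.notMem he))).trans (hmono _ _ (hd.symm.trans hd')), hGH hdx'⟩
    refine hadj (hLS.adj_of_sees (hSΩ c hc) (fun h => hcx₀ h.2 : x₀ ∉ S) hxy ?_
      (hcS _ hcx) (hcS _ hcy) (hx₀S x ⟨hx, hcx⟩) (hx₀S y ⟨hy, hcy⟩))
    intro hconn
    have : Conn G Ω c x₀ := by
      refine hconn.transfer fun a b _ ha hab _ hb => ?_
      have hbag := (inBag_of_bagGraph_adj (hle hab) (ha.notMem hc)).of_conn ha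
      exact hbag.resolve_right hb
    exact this.notMem hc hx₀
  · intro t ht hΩt v hv
    by_contra hvΩ
    obtain ⟨x, hx, hvx⟩ := h.1 v hvΩ
    have hadj := ht hv (hΩt hx) (by rintro rfl; exact hvΩ hx)
    rcases inBag_of_bagGraph_adj (hle hadj) hvΩ with h | h
    · exact h.notMem hvΩ hx
    · exact hvx h.2

/-- A component seeing all of `Ω` would contain a vertex adjacent in `H` to all of `Ω`, against
maximality. If a nonadjacent pair `u`, `v` of `Ω` were covered by no component, then intersecting
`H` with `bagGraph G Ω` and deleting the edge `uv` would give a smaller triangulation. -/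
theorem IsPMC.pmcCond [Finite V] {Ω : Finset V} (h : IsPMC G Ω) : PMCCond G (Ω : Set V) := by
  classical
  cases nonempty_fintype V
  obtain ⟨H, hmin, hmax⟩ := h
  obtain ⟨hGH, hH⟩ := hmin.prop
  have hLS := hH.locallySimplicial
  have hclique := hmax.prop
  refine ⟨?_, ?_⟩
  · intro c hc
    by_contra! hall
    obtain ⟨v, hv, hvΩ⟩ := hLS.exists_universal hclique hc fun x hx =>
      let ⟨d, hd, hdx⟩ := hall x hx
      ⟨d, hd.mono (fun _ _ _ _ h => hGH h) fun _ h => h, hGH hdx⟩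
    have hvmem := hv.notMem hc
    refine hvmem (hmax.le_of_ge (y := insert v (Ω : Set V)) ?_ (Set.subset_insert _ _)
      (Set.mem_insert _ _))
    exact hclique.insert fun x hx _ => hvΩ x hx
  · intro u hu v hv huv hadj
    by_contra! hcov
    let H' : SimpleGraph V :=
      { Adj := fun x y => H.Adj x y ∧ (bagGraph G Ω).Adj x y ∧ s(x, y) ≠ s(u, v)
        symm := ⟨fun x y h => ⟨h.1.symm, h.2.1.symm, by rw [Sym2.eq_swap]; exact h.2.2⟩⟩
        loopless := ⟨fun x h => h.1.ne rfl⟩ }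
    have hGH' : G ≤ H' := by
      intro x y h
      refine ⟨hGH h, le_bagGraph G Ω h, fun he => hadj ?_⟩
      rw [Sym2.eq_iff] at he
      rcases he with ⟨rfl, rfl⟩ | ⟨rfl, rfl⟩
      · exact h
      · exact h.symm
    have helim : HasElimination H' := by
      intro U hU
      by_cases hUΩ : ∃ c ∈ U, c ∉ Ω
      · obtain ⟨c, hcU, hc⟩ := hUΩ
        -- Work inside one bag and find an `H`-simplicial vertex of it outside `Ω`. Its neighbours
        -- in the new graph stay in that bag, which does not contain both `u` and `v`.
        obtain ⟨s, hs, hsΩ, hsimp⟩ := hLS.exists_simplicialIn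
          (U := U.filter (InBag G Ω c)) (K := {x | x ∈ Ω ∧ x ∈ U ∧ InBag G Ω c x}) (c := c)
          (hclique.subset fun x hx => hx.1)
          (Finset.mem_filter.2 ⟨hcU, Or.inl (Conn.refl _ _ _)⟩) (fun h => hc h.1)
          (fun x hx => Finset.mem_coe.2 (Finset.mem_filter.2 hx.2))
        obtain ⟨hsU, hsc⟩ := Finset.mem_filter.1 hs
        have hsΩ : s ∉ (Ω : Set V) := fun h => hsΩ ⟨h, hsU, hsc⟩
        have hbag : ∀ a, H'.Adj s a → InBag G Ω c a := fun a ha =>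
          (inBag_of_bagGraph_adj ha.2.1 hsΩ).of_conn (hsc.conn hsΩ)
        refine ⟨s, hsU, fun a ha b hb hsa hsb hab => ⟨?_, ⟨hab, Or.inr ⟨c, hc, hbag a hsa,
          hbag b hsb⟩⟩, ?_⟩⟩
        · exact hsimp a (Finset.mem_filter.2 ⟨ha, hbag a hsa⟩) b
            (Finset.mem_filter.2 ⟨hb, hbag b hsb⟩) hsa.1 hsb.1 hab
        · intro he
          have hbag' : ∀ x ∈ Ω, InBag G Ω c x → Sees G Ω c x := fun x hx h =>
            (h.resolve_left fun h => h.notMem hc hx).2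
          rw [Sym2.eq_iff] at he
          rcases he with ⟨rfl, rfl⟩ | ⟨rfl, rfl⟩
          · exact hcov c hc (hbag' _ hu (hbag _ hsa)) (hbag' _ hv (hbag _ hsb))
          · exact hcov c hc (hbag' _ hu (hbag _ hsb)) (hbag' _ hv (hbag _ hsa))
      · push Not at hUΩ
        -- Inside the clique `Ω` only the pair `uv` is missing, so `u` itself is simplicial; if `u`
        -- is not in `U`, any vertex will do.
        obtain ⟨s, hsU, hs⟩ : ∃ s ∈ U, s = u ∨ u ∉ U := by
          by_cases h : u ∈ U
          · exact ⟨u, h, Or.inl rfl⟩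
          · exact ⟨_, hU.choose_spec, Or.inr h⟩
        refine ⟨s, hsU, fun a ha b hb hsa hsb hab => ⟨hclique (hUΩ a ha) (hUΩ b hb) hab,
          ⟨hab, Or.inl ⟨hUΩ a ha, hUΩ b hb⟩⟩, fun he => ?_⟩⟩
        have hu' : u ∈ U ∧ (a = u ∨ b = u) := by
          rw [Sym2.eq_iff] at he
          rcases he with ⟨rfl, rfl⟩ | ⟨rfl, rfl⟩
          · exact ⟨ha, Or.inl rfl⟩
          · exact ⟨hb, Or.inr rfl⟩
        obtain rfl := hs.resolve_right fun h => h hu'.1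
        rcases hu'.2 with rfl | rfl
        · exact hsa.ne rfl
        · exact hsb.ne rfl
    have hle := hmin.le_of_le ⟨hGH', helim.isChordal⟩ fun _ _ h => h.1
    exact (hle (hclique hu hv huv)).2.2 rfl

theorem isPMC_iff [Finite V] {Ω : Finset V} : IsPMC G Ω ↔ PMCCond G (Ω : Set V) :=
  ⟨IsPMC.pmcCond, PMCCond.isPMC⟩

end PMC

/-! ### The structure of vital potential maximal cliques -/

section Vital

variable {V : Type*} {G : SimpleGraph V} {k : ℕ} {Ω : Finset V}

open Classical in
/-- The vertices of `Ω` other than `x` that are not adjacent to `x`. -/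
noncomputable def missing (G : SimpleGraph V) (Ω : Finset V) (x : V) : Finset V :=
  Ω.filter fun y => x ≠ y ∧ ¬ G.Adj x y

/-- Counts ordered pairs in `Ω × Ω` as adjacent, distinct nonadjacent, and diagonal. Being
subtraction-free, it turns vitality into a bound on the sum of the `missing` cardinalities. -/
theorem twice_card_edges_induce (G : SimpleGraph V) (Ω : Finset V) :
    2 * (G.induce (Ω : Set V)).edgeSet.ncard + ∑ x ∈ Ω, (missing G Ω x).card + Ω.card =
      Ω.card * Ω.card := by
  classical
  have h1 : 2 * (G.induce (Ω : Set V)).edgeSet.ncard =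
      ∑ x ∈ Ω, (Ω.filter fun y => G.Adj x y).card := by
    rw [Set.ncard_eq_toFinset_card', ← SimpleGraph.edgeFinset,
      ← SimpleGraph.sum_degrees_eq_twice_card_edges]
    rw [← Finset.sum_coe_sort Ω]
    refine Finset.sum_congr rfl fun x _ => ?_
    rw [← SimpleGraph.card_neighborFinset_eq_degree]
    refine Finset.card_bij (fun y _ => (y : V)) ?_ ?_ ?_
    · intro y hy
      simpa using hy
    · intro y _ y' _ h
      exact Subtype.ext h
    · intro y hy
      simp only [Finset.mem_filter] at hy
      exact ⟨⟨y, hy.1⟩, by simpa using hy.2, rfl⟩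
  rw [h1, ← Finset.sum_add_distrib, Finset.card_eq_sum_ones Ω, ← Finset.sum_add_distrib,
    Finset.sum_mul, ← Finset.card_eq_sum_ones]
  refine Finset.sum_congr rfl fun x hx => ?_
  have h2 : Ω.filter (fun y => ¬ G.Adj x y) = insert x (missing G Ω x) := by
    ext y
    simp only [missing, Finset.mem_filter, Finset.mem_insert]
    by_cases h : x = y
    · subst h; simp [hx]
    · simp [h, Ne.symm h]
  have h3 : (insert x (missing G Ω x)).card = (missing G Ω x).card + 1 :=
    Finset.card_insert_of_notMem (by simp [missing])
  have h4 := Finset.card_filter_add_card_filter_not (s := Ω) (fun y => G.Adj x y)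
  rw [h2, h3] at h4
  omega

theorem isVitalPMC_iff [Finite V] :
    IsVitalPMC G k Ω ↔ PMCCond G (Ω : Set V) ∧ ∑ x ∈ Ω, (missing G Ω x).card ≤ 2 * k := by
  rw [IsVitalPMC, isPMC_iff]
  refine and_congr_right fun _ => ?_
  have h := twice_card_edges_induce G Ω
  rify at h ⊢
  constructor <;> intro h' <;> linarith

/-- Every new edge inside `N(w)` can be replaced by a detour through `w`, which lies outside `Ω`. So
neither the components outside `Ω` nor what they see changes. -/
theorem PMCCond.completeOn {w : V} (h : PMCCond G (Ω : Set V)) (hw : w ∉ Ω) :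
    PMCCond (completeOn G (G.neighborSet w)) (Ω : Set V) := by
  have hle : ∀ x y, G.Adj x y → (FillIn.completeOn G (G.neighborSet w)).Adj x y :=
    fun _ _ h => Or.inl h
  have hconn : ∀ c d, Conn (FillIn.completeOn G (G.neighborSet w)) Ω c d → Conn G Ω c d := by
    intro c d h
    refine h.transfer fun x y _ hx hxy hx' hy' => ?_
    rcases hxy with hxy | ⟨-, hwx, hwy⟩
    · exact hx.tail hxy hx' hy'
    · exact (hx.tail (G.adj_symm hwx) hx' hw).tail hwy hw hy'
  have hsees : ∀ c x, c ∉ (Ω : Set V) →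
      (Sees (FillIn.completeOn G (G.neighborSet w)) Ω c x ↔ Sees G Ω c x) := by
    intro c x hc
    constructor
    · rintro ⟨d, hd, hdx⟩
      have hd := hconn _ _ hd
      rcases hdx with hdx | ⟨-, hwd, hwx⟩
      · exact ⟨d, hd, hdx⟩
      · exact ⟨w, hd.tail (G.adj_symm hwd) (hd.notMem hc) hw, hwx⟩
    · rintro ⟨d, hd, hdx⟩
      exact ⟨d, hd.mono (fun _ _ _ _ h => hle _ _ h) fun _ h => h, hle _ _ hdx⟩
  refine ⟨fun c hc => ?_, fun x hx y hy hxy hadj => ?_⟩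
  · obtain ⟨x, hx, hcx⟩ := h.1 c hc
    exact ⟨x, hx, fun h => hcx ((hsees c x hc).1 h)⟩
  · obtain ⟨c, hc, hcx, hcy⟩ := h.2 x hx y hy hxy fun h => hadj (Or.inl h)
    exact ⟨c, hc, (hsees c x hc).2 hcx, (hsees c y hc).2 hcy⟩

/-- In a non-reducible instance, two nonadjacent vertices of `Ω` are both seen by a vertex outside
`Ω` that misses few of their common neighbours. -/
theorem NonReducible.exists_unobscured [Finite V] (hG : NonReducible G k)
    (hΩ : PMCCond G (Ω : Set V)) {u v : V} (hu : u ∈ Ω) (hv : v ∈ Ω) (huv : u ≠ v)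
    (hadj : ¬ G.Adj u v) :
    ∃ w ∉ Ω, ((G.commonNeighbors u v \ G.neighborSet w).ncard : ℝ) < √(k : ℝ) := by
  -- The induced path runs through a component covering `u` and `v`, which places its internal
  -- vertices outside `Ω`.
  obtain ⟨c, hc, ⟨d, hd, hdu⟩, ⟨d', hd', hdv⟩⟩ := hΩ.2 u hu v hv huv hadj
  obtain ⟨p, hp, hS, hgeo, -⟩ :=
    exists_geodesic hdu.symm (hd.symm.trans hd') hdv (hd.notMem hc) hadj huv
  have hchord : p.IsChordless := by
    rw [SimpleGraph.Walk.isChordless_iff_forall_mem_edges]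
    intro x y hx hy hxy
    obtain ⟨i, rfl, hi⟩ := SimpleGraph.Walk.mem_support_iff_exists_getVert.1 hx
    obtain ⟨j, rfl, hj⟩ := SimpleGraph.Walk.mem_support_iff_exists_getVert.1 hy
    rw [SimpleGraph.Walk.mk_mem_edges_iff_exists]
    rcases lt_trichotomy i j with hij | rfl | hij
    · obtain rfl := hgeo i j hij hj hxy
      exact ⟨i, hj, rfl⟩
    · exact absurd rfl hxy.ne
    · obtain rfl := hgeo j i hij hi hxy.symm
      exact ⟨j, hi, Sym2.eq_swap⟩
  have := hG u v p huv hadj hp hchord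
  unfold IsObscured at this
  push Not at this
  obtain ⟨w, hw, hwu, hwv, h⟩ := this
  exact ⟨w, hS w hw hwu hwv, h⟩

/-- The vertex `w` misses at most `u`, `v`, the vertices missed by `u` or by `v`, and fewer than
`√k` common neighbours of `u` and `v`. This is at most `3√k + 2`, hence at most `5√k`, because `k =
0` would make `Ω` a clique. -/
theorem IsVitalPMC.exists_vertex [Finite V] (hG : NonReducible G k) (hΩ : IsVitalPMC G k Ω)
    (hq : ¬ ∃ Z : Finset V, Z ⊆ Ω ∧ (Z.card : ℝ) ≤ 5 * √(k : ℝ) ∧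
      G.IsClique ((Ω : Set V) \ (Z : Set V))) :
    ∃ w ∉ Ω, (((Ω : Set V) \ G.neighborSet w).ncard : ℝ) ≤ 5 * √(k : ℝ) := by
  classical
  obtain ⟨hpmc, hmiss⟩ := isVitalPMC_iff.1 hΩ
  have hk : 1 ≤ k := by
    by_contra hk
    obtain rfl : k = 0 := by omega
    refine hq ⟨∅, by simp, by simp, fun x hx y hy hxy => ?_⟩
    by_contra hadj
    have hx : x ∈ Ω := hx.1
    have h0 := Finset.sum_eq_zero_iff.1 (Nat.le_zero.1 hmiss) x hx
    rw [Finset.card_eq_zero] at h0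
    have : y ∈ missing G Ω x := Finset.mem_filter.2 ⟨hy.1, hxy, hadj⟩
    simp [h0] at this
  have hk' : (1 : ℝ) ≤ √(k : ℝ) := by
    rw [Real.one_le_sqrt]; exact_mod_cast hk
  -- At most `2√k` vertices miss `√k` or more others, the total being at most `2k`; so `Ω \ Z` is
  -- not a clique.
  let Z := Ω.filter fun x => √(k : ℝ) ≤ (missing G Ω x).card
  have hZ : (Z.card : ℝ) ≤ 2 * √(k : ℝ) := by
    have h1 : (Z.card : ℝ) * √(k : ℝ) ≤ ∑ x ∈ Ω, ((missing G Ω x).card : ℝ) := by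
      rw [← nsmul_eq_mul]
      refine (Finset.card_nsmul_le_sum Z (fun x => ((missing G Ω x).card : ℝ)) _
        fun x hx => (Finset.mem_filter.1 hx).2).trans ?_
      exact Finset.sum_le_sum_of_subset_of_nonneg (Finset.filter_subset _ _)
        fun _ _ _ => Nat.cast_nonneg _
    have h2 : (∑ x ∈ Ω, ((missing G Ω x).card : ℝ)) ≤ 2 * k := by exact_mod_cast hmiss
    have h3 : √(k : ℝ) * √(k : ℝ) = k := Real.mul_self_sqrt (Nat.cast_nonneg _)
    nlinarith
  have hncl : ¬ G.IsClique ((Ω : Set V) \ (Z : Set V)) := fun h =>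
    hq ⟨Z, Finset.filter_subset _ _, by linarith, h⟩
  obtain ⟨u, hu, v, hv, huv, hadj⟩ : ∃ u ∈ (Ω : Set V) \ (Z : Set V),
      ∃ v ∈ (Ω : Set V) \ (Z : Set V), u ≠ v ∧ ¬ G.Adj u v := by
    simpa [SimpleGraph.IsClique, Set.Pairwise, and_assoc] using hncl
  have hsmall : ∀ u ∈ (Ω : Set V) \ (Z : Set V), ((missing G Ω u).card : ℝ) < √(k : ℝ) := by
    intro u hu
    by_contra h
    exact hu.2 (Finset.mem_filter.2 ⟨hu.1, not_lt.1 h⟩)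
  obtain ⟨w, hw, hwk⟩ := hG.exists_unobscured hpmc hu.1 hv.1 huv hadj
  refine ⟨w, hw, ?_⟩
  have hsub : (Ω : Set V) \ G.neighborSet w ⊆ (insert u (missing G Ω u) : Finset V) ∪
      ((insert v (missing G Ω v) : Finset V) ∪ (G.commonNeighbors u v \ G.neighborSet w)) := by
    rintro x ⟨hx, hxw⟩
    by_cases h1 : x ∈ insert u (missing G Ω u)
    · exact Or.inl h1
    by_cases h2 : x ∈ insert v (missing G Ω v)
    · exact Or.inr (Or.inl h2)
    refine Or.inr (Or.inr ⟨?_, hxw⟩)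
    simp only [missing, Finset.mem_insert, Finset.mem_filter, not_or, not_and, not_not] at h1 h2
    exact ⟨h1.2 hx (Ne.symm h1.1), h2.2 hx (Ne.symm h2.1)⟩
  have h1 := (Set.ncard_le_ncard hsub (Set.toFinite _)).trans ((Set.ncard_union_le _ _).trans
    (Nat.add_le_add_left (Set.ncard_union_le _ _) _))
  rw [Set.ncard_coe_finset, Set.ncard_coe_finset] at h1
  have h2 := Finset.card_insert_le u (missing G Ω u)
  have h3 := Finset.card_insert_le v (missing G Ω v)
  have h4 := hsmall u hu
  have h5 := hsmall v hv
  rify at h1 h2 h3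
  linarith

theorem IsVitalPMC.exists_isQuasiClique_completeOn [Finite V] (hG : NonReducible G k)
    (hΩ : IsVitalPMC G k Ω) (hq : ¬ IsQuasiClique G k Ω) :
    ∃ w, w ∉ Ω ∧ (((Ω : Set V) \ G.neighborSet w).ncard : ℝ) ≤ 5 * √(k : ℝ) + 2 ∧
      IsQuasiClique (completeOn G (G.neighborSet w)) k Ω := by
  classical
  obtain ⟨w, hw, hcard⟩ := hΩ.exists_vertex hG fun h => hq ⟨hΩ.1, h⟩
  refine ⟨w, hw, by linarith, (hΩ.1.pmcCond.completeOn hw).isPMC,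
    Ω.filter fun x => x ∉ G.neighborSet w, Finset.filter_subset _ _, ?_, ?_⟩
  · rw [← Set.ncard_coe_finset, Finset.coe_filter]
    exact hcard
  · rintro x ⟨hx, hx'⟩ y ⟨hy, hy'⟩ hxy
    simp only [Finset.coe_filter, Set.mem_ofPred_eq, not_and, not_not] at hx' hy'
    exact Or.inr ⟨hxy, hx' hx, hy' hy⟩

end Vital

/-! ### Chordal completion -/

/-- Each application that changes the argument raises the rank, so a rank bounded by `m` allows at
most `m` changes. This justifies fixed iteration counts for the graph closure and for component
search. -/
theorem iterate_eq_of_rank {α : Type*} (f : α → α) (r : α → ℕ) (hr : ∀ x, f x ≠ x → r x < r (f x))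
    {m : ℕ} (hm : ∀ x, r x ≤ m) (x : α) : f (f^[m] x) = f^[m] x := by
  by_contra hne
  have h1 : ∀ j, j ≤ m → f (f^[j] x) ≠ f^[j] x := by
    intro j hj h
    refine hne ?_
    obtain ⟨d, rfl⟩ := Nat.exists_eq_add_of_le' hj
    rw [Function.iterate_add_apply, Function.iterate_fixed h, h]
  have h2 : ∀ j, j ≤ m + 1 → j ≤ r (f^[j] x) := by
    intro j hj
    induction j with
    | zero => exact Nat.zero_le _
    | succ j ih =>
      rw [Function.iterate_succ_apply']
      exact (Nat.succ_le_succ (ih (by omega))).trans (hr _ (h1 j (by omega)))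
  have := (h2 (m + 1) le_rfl).trans (hm _)
  omega

section Closure

variable {V : Type*} {G H K : SimpleGraph V}

/-- Join any two vertices witnessing that `H` is not locally simplicial. -/
def lbStep (H : SimpleGraph V) : SimpleGraph V where
  Adj p q := H.Adj p q ∨ (p ≠ q ∧ ∃ v c d, H.Adj v p ∧ H.Adj v q ∧
    c ∉ insert v (H.neighborSet v) ∧ H.Adj p c ∧
    Conn H (insert v (H.neighborSet v)) c d ∧ H.Adj d q)
  symm := ⟨fun _ _ h => h.imp H.adj_symm fun ⟨hne, v, c, d, hp, hq, hc, hpc, hcd, hdq⟩ =>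
    ⟨hne.symm, v, d, c, hq, hp, hcd.notMem hc, hdq.symm, hcd.symm, hpc.symm⟩⟩
  loopless := ⟨fun _ h => h.elim (fun h => h.ne rfl) fun h => h.1 rfl⟩

theorem le_lbStep (H : SimpleGraph V) : H ≤ lbStep H := fun _ _ => Or.inl

/-- Iterating `lbStep` until it stabilizes. -/
noncomputable def lbClosure (K : SimpleGraph V) : SimpleGraph V :=
  (lbStep^[Nat.card V])^[Nat.card V] K

theorem iterate_lbStep_induction {P : SimpleGraph V → Prop} (hK : P K)
    (hstep : ∀ H, P H → P (lbStep H)) : P (lbClosure K) := by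
  rw [lbClosure, ← Function.iterate_mul]
  generalize Nat.card V * Nat.card V = m
  induction m with
  | zero => exact hK
  | succ m ih => rw [Function.iterate_succ_apply']; exact hstep _ ih

theorem le_lbClosure (K : SimpleGraph V) : K ≤ lbClosure K :=
  iterate_lbStep_induction le_rfl fun _ h => h.trans (le_lbStep _)

theorem lbStep_lbClosure [Finite V] (K : SimpleGraph V) : lbStep (lbClosure K) = lbClosure K := by
  -- The rank is the number of adjacent ordered pairs, at most `n²`. The two nested `n`-fold
  -- iterations correspond to two nested loops over the vertex list.
  rw [lbClosure, ← Function.iterate_mul]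
  refine iterate_eq_of_rank lbStep (fun H => {p : V × V | H.Adj p.1 p.2}.ncard) ?_ ?_ K
  · intro H hne
    refine Set.ncard_lt_ncard ?_ (Set.toFinite _)
    refine Set.ssubset_iff_subset_ne.2 ⟨fun p hp => Or.inl hp, fun h => hne ?_⟩
    ext p q
    exact (Set.ext_iff.1 h (p, q)).symm
  · intro H
    exact (Set.ncard_le_card _).trans (Nat.card_prod V V).le

theorem lbClosure_locallySimplicial [Finite V] (K : SimpleGraph V) :
    LocallySimplicial (lbClosure K) := by
  intro v p q c d hvp hvq hpq hc hpc hcd hdq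
  rw [← lbStep_lbClosure]
  exact Or.inr ⟨hpq, v, c, d, hvp, hvq, hc, hpc, hcd, hdq⟩

/-- The completion does not join different sides of a clique separator. -/
theorem conn_of_lbClosure_adj {X : Set V} (hX : K.IsClique X) {x y : V} (hx : x ∉ X) (hy : y ∉ X)
    (h : (lbClosure K).Adj x y) : Conn K X x y := by
  have key : K ≤ lbClosure K ∧ ∀ x y, x ∉ X → y ∉ X → (lbClosure K).Adj x y → Conn K X x y := by
    refine iterate_lbStep_induction (P := fun H => K ≤ H ∧ ∀ x y, x ∉ X → y ∉ X → H.Adj x y →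
      Conn K X x y) ⟨le_rfl, fun x y hx hy h => Conn.single h hx hy⟩ ?_
    rintro H ⟨hKH, hH⟩
    refine ⟨hKH.trans (le_lbStep _), fun p q hp hq h => ?_⟩
    rcases h with h | ⟨-, v, c, d, hvp, hvq, hc, hpc, hcd, hdq⟩
    · exact hH p q hp hq h
    -- If `v` is in the clique `X`, then `X` lies in `N[v]` and the linking path outside `N[v]`
    -- avoids `X`. Otherwise `p`, `v`, `q` is already a connection outside `X`.
    by_cases hv : v ∈ X
    · have hXN : ∀ x, x ∉ insert v (H.neighborSet v) → x ∉ X := by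
        intro x hx hxX
        by_cases hxv : x = v
        · exact hx (Or.inl hxv)
        · exact hx (Or.inr (hKH (hX hv hxX (Ne.symm hxv))))
      have hcd' : Conn K X c d := hcd.transfer fun a b _ ha hab haN hbN =>
        ha.trans (hH a b (hXN a haN) (hXN b hbN) hab)
      exact ((hH p c hp (hXN c hc) hpc).trans hcd').trans
        (hH d q (hXN d (hcd.notMem hc)) hq hdq)
    · exact (hH p v hp hv hvp.symm).trans (hH v q hv hq hvq)
  exact key.2 x y hx hy h

theorem conn_of_lbClosure {X : Set V} (hX : K.IsClique X) {x y : V}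
    (h : Conn (lbClosure K) X x y) : Conn K X x y :=
  h.transfer fun _ _ _ ha hab hx hy => ha.trans (conn_of_lbClosure_adj hX hx hy hab)

/-- A clique that is a minimal separator is the common neighbourhood of two vertices in the
completion. -/
theorem exists_lbClosure_commonNeighbors [Finite V] {S : Set V} (hS : K.IsClique S) {c z : V}
    (hc : c ∉ S) (hz : z ∉ S) (hcz : ¬ Conn K S c z) (hcS : ∀ x ∈ S, Sees K S c x)
    (hzS : ∀ x ∈ S, Sees K S z x) :
    ∃ a b, ∀ u, u ∈ S ↔ (lbClosure K).Adj a u ∧ (lbClosure K).Adj b u := by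
  have hle := le_lbClosure K
  have hS' : (lbClosure K).IsClique S := hS.mono hle
  have hsees : ∀ c x, Sees K S c x → Sees (lbClosure K) S c x := fun c x ⟨d, hd, hdx⟩ =>
    ⟨d, hd.mono (fun _ _ _ _ h => hle h) fun _ h => h, hle hdx⟩
  obtain ⟨a, hca, ha⟩ := (lbClosure_locallySimplicial K).exists_universal hS' hc
    fun x hx => hsees _ _ (hcS x hx)
  obtain ⟨b, hzb, hb⟩ := (lbClosure_locallySimplicial K).exists_universal hS' hz
    fun x hx => hsees _ _ (hzS x hx)
  refine ⟨a, b, fun u => ⟨fun hu => ⟨ha u hu, hb u hu⟩, fun ⟨hau, hbu⟩ => ?_⟩⟩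
  -- A common neighbour outside `S` would connect the two sides in the completion, hence already in
  -- `K`.
  by_contra hu
  have hab : Conn (lbClosure K) S a b :=
    (Conn.single hau (hca.notMem hc) hu).tail hbu.symm hu (hzb.notMem hz)
  exact hcz (conn_of_lbClosure hS ((hca.trans hab).trans hzb.symm))

/-- The graph `G` with all edges at `T` removed. -/
def isolate (G : SimpleGraph V) (T : Set V) : SimpleGraph V where
  Adj x y := G.Adj x y ∧ x ∉ T ∧ y ∉ T
  symm := ⟨fun _ _ h => ⟨h.1.symm, h.2.2, h.2.1⟩⟩
  loopless := ⟨fun _ h => h.1.ne rfl⟩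

/-- The vertices through which the component could enter `Ω` are blocked by `S` or isolated by `T`.
-/
theorem conn_of_isolate {Ω S T : Set V} {c d : V} (hc : c ∉ Ω)
    (hsees : ∀ x ∈ Ω, Sees G Ω c x → x ∈ S ∨ x ∈ T) (h : Conn (isolate G T) S c d) :
    Conn G Ω c d := by
  refine h.transfer fun x y _ hx hxy _ hyS => ?_
  refine hx.tail hxy.1 (hx.notMem hc) fun hy => ?_
  rcases hsees y hy ⟨x, hx, hxy.1⟩ with h | h
  · exact hyS h
  · exact hxy.2.2 h

theorem Conn.isolate {Ω S T : Set V} {c d : V} (hS : S ⊆ Ω) (hT : T ⊆ Ω) (h : Conn G Ω c d) :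
    Conn (isolate G T) S c d :=
  h.mono (fun _ _ hx hy h => ⟨h, fun h => hx (hT h), fun h => hy (hT h)⟩) fun _ h h' => h (hS h')

end Closure

/-! ### Candidates for potential maximal cliques -/

section Candidates

variable {V : Type*} [Fintype V] [DecidableEq V] {G : SimpleGraph V} {Ω Z : Finset V}

open Classical in
/-- `Z` together with the common neighbours of `a` and `b` in the completion of `G - (Z \ z)`. -/
noncomputable def sepCandidate (G : SimpleGraph V) (Z : Finset V) (z a b : V) : Finset V :=
  Finset.univ.filter fun u => u ∈ Z ∨
    ((lbClosure (isolate G {x | x ∈ Z ∧ x ≠ z})).Adj a u ∧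
      (lbClosure (isolate G {x | x ∈ Z ∧ x ≠ z})).Adj b u)

open Classical in
/-- `Z` together with the vertices whose closed neighbourhood, in the completion of `G - (Z \ z)`,
contains `z` and the common neighbours of `a` and `b`. -/
noncomputable def cliqueCandidate (G : SimpleGraph V) (Z : Finset V) (z a b : V) : Finset V :=
  Finset.univ.filter fun u => u ∈ Z ∨
    ∀ x, (x = z ∨ ((lbClosure (isolate G {x | x ∈ Z ∧ x ≠ z})).Adj a x ∧
      (lbClosure (isolate G {x | x ∈ Z ∧ x ≠ z})).Adj b x)) →
        x = u ∨ (lbClosure (isolate G {x | x ∈ Z ∧ x ≠ z})).Adj u x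

open Classical in
/-- `Z` together with the neighbours of the component of `z` outside `N[w]` and `Z \ z`. -/
noncomputable def nbrCandidate (G : SimpleGraph V) (Z : Finset V) (z w : V) : Finset V :=
  Finset.univ.filter fun u => u ∈ Z ∨
    (¬ Conn G {x | x = w ∨ G.Adj w x ∨ (x ∈ Z ∧ x ≠ z)} z u ∧
      Sees G {x | x = w ∨ G.Adj w x ∨ (x ∈ Z ∧ x ≠ z)} z u)

/-- Some component sees the whole clique `X = Ω \ Z`, so it fails to see some `z` in `Z`. With `Z \
z` isolated, `X` separates that component from `z`. The side of `z` also sees all of `X`, by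
adjacency or through covering components, so `X` is the common neighbourhood of two vertices in the
completion. -/
theorem PMCCond.exists_sepCandidate (h : PMCCond G (Ω : Set V)) (hZ : Z ⊆ Ω)
    (hcl : G.IsClique ((Ω : Set V) \ Z)) {c : V} (hc : c ∉ Ω)
    (hcX : ∀ x ∈ (Ω : Set V) \ Z, Sees G Ω c x) : ∃ z a b, Ω = sepCandidate G Z z a b := by
  obtain ⟨z, hz, hcz⟩ := h.1 c hc
  have hzZ : z ∈ Z := by
    by_contra hzZ
    exact hcz (hcX z ⟨hz, hzZ⟩)
  set T : Set V := {x | x ∈ Z ∧ x ≠ z} with hT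
  set X : Set V := (Ω : Set V) \ Z with hX
  have hXT : ∀ x ∈ X, x ∉ T := fun x hx h => hx.2 h.1
  have hTΩ : T ⊆ Ω := fun x hx => hZ hx.1
  have hXΩ : X ⊆ Ω := Set.sdiff_subset
  have hzX : z ∉ X := fun h => h.2 hzZ
  have h1 : ¬ Conn (isolate G T) X c z := by
    intro hconn
    refine (conn_of_isolate (Ω := (Ω : Set V)) hc ?_ hconn).notMem hc hz
    intro x hx hcx
    by_cases hxZ : x ∈ Z
    · exact Or.inr ⟨hxZ, by rintro rfl; exact hcz hcx⟩
    · exact Or.inl ⟨hx, hxZ⟩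
  have h2 : ∀ x ∈ X, Sees (isolate G T) X c x := by
    intro x hx
    obtain ⟨d, hd, hdx⟩ := hcX x hx
    exact ⟨d, hd.isolate hXΩ hTΩ, hdx, fun h => hd.notMem hc (hTΩ h), hXT x hx⟩
  have h3 : ∀ x ∈ X, Sees (isolate G T) X z x := by
    intro x hx
    have hzT : z ∉ T := fun h => h.2 rfl
    by_cases hadj : G.Adj z x
    · exact ⟨z, Conn.refl _ _ _, hadj, hzT, hXT x hx⟩
    · obtain ⟨e, he, ⟨d, hd, hdz⟩, ⟨d', hd', hdx⟩⟩ := h.2 z hz x hx.1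
        (by rintro rfl; exact hzX hx) hadj
      have hdT : d ∉ T := fun h => hd.notMem he (hTΩ h)
      have hdX : d ∉ X := fun h => hd.notMem he (hXΩ h)
      have hdT' : d' ∉ T := fun h => hd'.notMem he (hTΩ h)
      exact ⟨d', (Conn.single (G := isolate G T) ⟨hdz.symm, hzT, hdT⟩ hzX hdX).trans
        ((hd.symm.trans hd').isolate hXΩ hTΩ), hdx, hdT', hXT x hx⟩
  obtain ⟨a, b, hab⟩ := exists_lbClosure_commonNeighbors (K := isolate G T) (S := X) (c := c)
    (z := z) (fun x hx y hy hxy => ⟨hcl hx hy hxy, hXT x hx, hXT y hy⟩) (fun h => hc h.1) hzX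
    h1 h2 h3
  refine ⟨z, a, b, ?_⟩
  ext u
  simp only [sepCandidate, Finset.mem_filter, Finset.mem_univ, true_and]
  rw [← hT, ← hab]
  simp only [hX, Set.mem_sdiff, Finset.mem_coe]
  constructor
  · intro hu
    by_cases huZ : u ∈ Z
    · exact Or.inl huZ
    · exact Or.inr ⟨hu, huZ⟩
  · rintro (hu | hu)
    · exact hZ hu
    · exact hu.1

/-- Here every component misses a vertex of `Ω \ Z`. Take a minimal `Y ⊆ Ω \ Z` such that every
component misses a member, and `z` in `Y`: by minimality some component `c₁` sees `Y \ z` but not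
`z`. Its neighbourhood in `Ω \ Z` is a clique separating it from `z`, hence recoverable, and
together with `z` it contains `Y`, which suffices to exclude every vertex outside `Ω`. -/
theorem exists_cliqueCandidate (hZ : Z ⊆ Ω)
    (hcl : G.IsClique ((Ω : Set V) \ Z)) {c : V} (hc : c ∉ Ω)
    (hX : ∀ c, c ∉ Ω → ∃ x ∈ (Ω : Set V) \ Z, ¬ Sees G Ω c x) :
    ∃ z a b, Ω = cliqueCandidate G Z z a b := by
  obtain ⟨Y, hYX, hY⟩ := exists_minimal_le_of_wellFoundedLT
    (fun Y : Finset V => ∀ c, c ∉ Ω → ∃ x ∈ Y, ¬ Sees G Ω c x) (Ω \ Z) (by simpa using hX)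
  obtain ⟨z, hzY, -⟩ := hY.prop c hc
  have hYX' : ∀ y ∈ Y, y ∈ Ω ∧ y ∉ Z := fun y hy => by simpa using hYX hy
  obtain ⟨hzΩ, hzZ⟩ := hYX' z hzY
  obtain ⟨c₁, hc₁, hc₁Y⟩ : ∃ c, c ∉ Ω ∧ ∀ x ∈ Y.erase z, Sees G Ω c x := by
    by_contra! hcon
    have := hY.le_of_le (y := Y.erase z) hcon (Finset.erase_subset _ _) hzY
    simp at this
  have hc₁z : ¬ Sees G Ω c₁ z := by
    obtain ⟨x, hx, hx'⟩ := hY.prop c₁ hc₁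
    by_cases hxz : x = z
    · exact hxz ▸ hx'
    · exact absurd (hc₁Y x (Finset.mem_erase.2 ⟨hxz, hx⟩)) hx'
  -- Since `z` is not in `Z`, the definition here isolates all of `Z`.
  have hT : {x | x ∈ Z ∧ x ≠ z} = (Z : Set V) := by
    ext x
    simp only [Set.mem_ofPred_eq, Finset.mem_coe, and_iff_left_iff_imp]
    rintro hx rfl
    exact hzZ hx
  set K := isolate G (Z : Set V) with hK
  let S : V → Set V := fun c => {x | x ∈ Ω ∧ x ∉ Z ∧ Sees G Ω c x}
  have hSΩ : ∀ c, S c ⊆ Ω := fun c x hx => hx.1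
  have hS : ∀ c, K.IsClique (S c) := fun c x hx y hy hxy =>
    ⟨hcl ⟨hx.1, hx.2.1⟩ ⟨hy.1, hy.2.1⟩ hxy, hx.2.1, hy.2.1⟩
  have hconn : ∀ c d, c ∉ Ω → Conn K (S c) c d → Conn G Ω c d := fun c d hc h =>
    conn_of_isolate (Ω := (Ω : Set V)) hc (fun x hx hcx => by
      by_cases hxZ : x ∈ Z
      · exact Or.inr hxZ
      · exact Or.inl ⟨hx, hxZ, hcx⟩) h
  obtain ⟨a, b, hab⟩ := exists_lbClosure_commonNeighbors (hS c₁) (c := c₁) (z := z)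
    (fun h => hc₁ h.1) (fun h => hc₁z h.2.2) (fun h => (hconn _ _ hc₁ h).notMem hc₁ hzΩ)
    (fun x hx => by
      obtain ⟨d, hd, hdx⟩ := hx.2.2
      exact ⟨d, hd.isolate (hSΩ _) hZ, hdx, fun h => hd.notMem hc₁ (hZ h), hx.2.1⟩)
    (fun x hx => ⟨z, Conn.refl _ _ _, hcl ⟨hzΩ, hzZ⟩ ⟨hx.1, hx.2.1⟩
      (by rintro rfl; exact hc₁z hx.2.2), hzZ, hx.2.1⟩)
  refine ⟨z, a, b, ?_⟩
  ext u
  simp only [cliqueCandidate, Finset.mem_filter, Finset.mem_univ, true_and]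
  rw [hT, ← hK]
  simp only [← hab]
  constructor
  · intro hu
    by_cases huZ : u ∈ Z
    · exact Or.inl huZ
    · refine Or.inr fun x hx => ?_
      have hx' : x ∈ (Ω : Set V) \ Z := by
        rcases hx with rfl | hx
        · exact ⟨hzΩ, hzZ⟩
        · exact ⟨hx.1, hx.2.1⟩
      by_cases hxu : x = u
      · exact Or.inl hxu
      · exact Or.inr (le_lbClosure K
          ⟨hcl ⟨hu, huZ⟩ hx' (Ne.symm hxu), huZ, hx'.2⟩)
  · rintro (hu | hu)
    · exact hZ hu
    · by_contra huΩ
      obtain ⟨y, hy, huy⟩ := hY.prop u huΩ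
      obtain ⟨hyΩ, hyZ⟩ := hYX' y hy
      have hmem : y = z ∨ y ∈ S c₁ := by
        by_cases hyz : y = z
        · exact Or.inl hyz
        · exact Or.inr ⟨hyΩ, hyZ, hc₁Y y (Finset.mem_erase.2 ⟨hyz, hy⟩)⟩
      rcases hu y hmem with rfl | hadj
      · exact huΩ hyΩ
      · have := conn_of_lbClosure_adj (hS u) (fun h => huΩ h.1) (fun h => huy h.2.2) hadj
        exact (hconn _ _ huΩ this).notMem huΩ hyΩ

/-- Let `z` in `Ω` be unseen by the component of `w`. Outside `N[w] ∪ (Z \ z)`, the component of `z`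
consists of `z` and vertices of other components of `G - Ω`. Its neighbours outside itself all lie
in `Ω`, and they include `Ω ∩ N(w)`, because each such vertex is adjacent to `z` or covered together
with `z`. -/
theorem PMCCond.exists_nbrCandidate (h : PMCCond G (Ω : Set V)) {w : V} (hw : w ∉ Ω)
    (hZ : ∀ x, x ∈ Z ↔ x ∈ Ω ∧ ¬ G.Adj w x) : ∃ z, Ω = nbrCandidate G Z z w := by
  obtain ⟨z, hz, hwz⟩ := h.1 w hw
  have hwz' : ¬ G.Adj w z := fun h => hwz ⟨w, Conn.refl _ _ _, h⟩
  have hzw : z ≠ w := by rintro rfl; exact hw hz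
  set S : Set V := {x | x = w ∨ G.Adj w x ∨ (x ∈ Z ∧ x ≠ z)} with hS
  have hzS : z ∉ S := by
    rintro (h | h | h)
    · exact hzw h
    · exact hwz' h
    · exact h.2 rfl
  have hmemS : ∀ x, x ∉ Ω → ¬ Conn G Ω w x → x ∉ S := by
    rintro x hx hwx (rfl | h | h)
    · exact hwx (Conn.refl _ _ _)
    · exact hwx (Conn.single h hw hx)
    · exact hx ((hZ x).1 h.1).1
  have hB : ∀ d, Conn G S z d → d = z ∨ (d ∉ Ω ∧ ¬ Conn G Ω w d) := by
    intro d hd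
    induction hd with
    | refl => exact Or.inl rfl
    | @tail a e _ hae ih =>
      obtain ⟨hadj, -, heS⟩ := hae
      by_cases he : e ∈ Ω
      · left
        by_contra hne
        exact heS (Or.inr (Or.inr ⟨(hZ e).2 ⟨he, fun h => heS (Or.inr (Or.inl h))⟩, hne⟩))
      · refine Or.inr ⟨he, fun hwe => ?_⟩
        rcases ih with rfl | ⟨ha, hwa⟩
        · exact hwz ⟨e, hwe, hadj.symm⟩
        · exact hwa (hwe.tail hadj.symm he ha)
  refine ⟨z, ?_⟩
  ext u
  simp only [nbrCandidate, Finset.mem_filter, Finset.mem_univ, true_and]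
  rw [← hS]
  constructor
  · intro hu
    by_cases hwu : G.Adj w u
    · refine Or.inr ⟨fun h => h.notMem hzS (Or.inr (Or.inl hwu)), ?_⟩
      have hzu : z ≠ u := by rintro rfl; exact hwz' hwu
      by_cases hadj : G.Adj z u
      · exact ⟨z, Conn.refl _ _ _, hadj⟩
      · obtain ⟨e, he, ⟨d, hd, hdz⟩, ⟨d', hd', hdu⟩⟩ := h.2 z hz u hu hzu hadj
        -- The covering component sees `z`, so it is not that of `w` and avoids `S` entirely.
        have hout : ∀ x, Conn G Ω d x → x ∉ S := fun x hx =>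
          hmemS x ((hd.trans hx).notMem he) fun hwx => hwz ⟨d, hwx.trans hx.symm, hdz⟩
        refine ⟨d', ?_, hdu⟩
        refine (Conn.single hdz.symm hzS (hout d (Conn.refl _ _ _))).trans ?_
        refine (hd.symm.trans hd').transfer fun x y hx hx' hxy hxΩ hyΩ => ?_
        exact hx'.tail hxy (hout x hx) (hout y (hx.tail hxy hxΩ hyΩ))
    · exact Or.inl ((hZ u).2 ⟨hu, hwu⟩)
  · rintro (hu | ⟨hzu, d, hd, hdu⟩)
    · exact ((hZ u).1 hu).1
    · by_contra huΩ
      have huS : u ∈ S := by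
        by_contra huS
        exact hzu (hd.tail hdu (hd.notMem hzS) huS)
      have hwu : Conn G Ω w u := by
        by_contra hwu
        exact hmemS u huΩ hwu huS
      rcases hB d hd with rfl | ⟨hdΩ, hwd⟩
      · exact hwz ⟨u, hwu, hdu.symm⟩
      · exact hwd (hwu.tail hdu.symm huΩ hdΩ)

/-- In a non-reducible instance every vital potential maximal clique is a candidate for some small
set `Z`. -/
theorem IsVitalPMC.exists_candidate {k : ℕ} (hG : NonReducible G k) (hΩ : IsVitalPMC G k Ω) :
    Ω = Finset.univ ∨ ∃ (Z : Finset V) (z a b : V), (Z.card : ℝ) ≤ 5 * √(k : ℝ) ∧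
      (Ω = sepCandidate G Z z a b ∨ Ω = cliqueCandidate G Z z a b ∨ Ω = nbrCandidate G Z z a) := by
  classical
  have hpmc := hΩ.1.pmcCond
  by_cases hq : ∃ Z : Finset V, Z ⊆ Ω ∧ (Z.card : ℝ) ≤ 5 * √(k : ℝ) ∧
      G.IsClique ((Ω : Set V) \ (Z : Set V))
  · obtain ⟨Z, hZΩ, hZ, hcl⟩ := hq
    by_cases hc : ∃ c, c ∉ Ω
    · right
      by_cases hX : ∀ c, c ∉ Ω → ∃ x ∈ (Ω : Set V) \ Z, ¬ Sees G Ω c x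
      · obtain ⟨c, hc⟩ := hc
        obtain ⟨z, a, b, h⟩ := exists_cliqueCandidate hZΩ hcl hc hX
        exact ⟨Z, z, a, b, hZ, Or.inr (Or.inl h)⟩
      · push Not at hX
        obtain ⟨c, hc, hcX⟩ := hX
        obtain ⟨z, a, b, h⟩ := hpmc.exists_sepCandidate hZΩ hcl hc hcX
        exact ⟨Z, z, a, b, hZ, Or.inl h⟩
    · push Not at hc
      exact Or.inl (Finset.eq_univ_iff_forall.2 hc)
  · obtain ⟨w, hw, hcard⟩ := hΩ.exists_vertex hG hq
    obtain ⟨z, hz⟩ := hpmc.exists_nbrCandidate (Z := Ω.filter fun x => ¬ G.Adj w x) hw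
      (fun x => Finset.mem_filter)
    refine Or.inr ⟨_, z, w, w, ?_, Or.inr (Or.inr hz)⟩
    rw [← Set.ncard_coe_finset, Finset.coe_filter]
    exact hcard

end Candidates

/-! ### Uniform feasibility of families of computations -/

section Programs

/-- Started in `s`, the program `p` halts within `T` time units in a store satisfying `Q`. -/
def Runs (p : Prog) (s : Store) (T : ℕ) (Q : Store → Prop) : Prop :=
  ∃ t s', Exec p s t s' ∧ t ≤ T ∧ Q s'

variable {p q : Prog} {s : Store} {T T' : ℕ} {Q R : Store → Prop}

theorem Runs.mono (h : Runs p s T Q) (hT : T ≤ T') (hQ : ∀ s', Q s' → R s') : Runs p s T' R :=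
  let ⟨t, s', hp, ht, hs⟩ := h
  ⟨t, s', hp, ht.trans hT, hQ s' hs⟩

theorem Runs.assign {x : ℕ} {e : Expr} (h : Q (Function.update s x (e.eval s))) :
    Runs (.assign x e) s (e.cost + 1) Q :=
  ⟨_, _, Exec.assign x e s, le_rfl, h⟩

theorem Runs.seq (hp : Runs p s T Q) (hq : ∀ s', Q s' → Runs q s' T' R) :
    Runs (.seq p q) s (T + T') R :=
  let ⟨_, s', hp, ht, hs⟩ := hp
  let ⟨_, s'', hq, ht', hs'⟩ := hq s' hs
  ⟨_, s'', Exec.seq hp hq, Nat.add_le_add ht ht', hs'⟩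

theorem Runs.ite {e : Expr} (hp : e.eval s ≠ .nil → Runs p s T Q)
    (hq : e.eval s = .nil → Runs q s T Q) : Runs (.ite e p q) s (e.cost + 1 + T) Q := by
  by_cases h : e.eval s = .nil
  · obtain ⟨t, s', hq, ht, hs⟩ := hq h
    exact ⟨_, s', Exec.ite_false h hq, Nat.add_le_add_left ht _, hs⟩
  · obtain ⟨t, s', hp, ht, hs⟩ := hp h
    exact ⟨_, s', Exec.ite_true h hp, Nat.add_le_add_left ht _, hs⟩

theorem Runs.loop {e : Expr} (I : ℕ → Store → Prop) {m : ℕ} (hs : I m s)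
    (hend : ∀ s, I 0 s → e.eval s = .nil ∧ Q s)
    (hstep : ∀ j, j < m → ∀ s, I (j + 1) s → e.eval s ≠ .nil ∧ Runs p s T (I j)) :
    Runs (.loop e p) s (m * (e.cost + 1 + T) + (e.cost + 1)) Q := by
  induction m generalizing s with
  | zero =>
    obtain ⟨h, hQ⟩ := hend s hs
    exact ⟨_, s, Exec.loop_done h, by simp, hQ⟩
  | succ m ih =>
    obtain ⟨h, t, s', hp, ht, hs'⟩ := hstep m (by omega) s hs
    obtain ⟨t', s'', hl, ht', hQ⟩ := ih hs' fun j hj => hstep j (by omega)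
    refine ⟨_, s'', Exec.loop_step h hp hl, ?_, hQ⟩
    rw [Nat.succ_mul]
    omega

end Programs

/-- The numbers `f i` are polynomially bounded in `N i`. -/
def PolyBdd {ι : Type} (N f : ι → ℕ) : Prop := ∃ c, ∀ i, f i ≤ (N i + 2) ^ c

/-- From `a i` one can compute `f i` by one program in time polynomial in `N i`. The program works
in the variables from `m` on, with input and output in variable `m`. -/
def Feas {ι : Type} (N : ι → ℕ) (a f : ι → Data) : Prop :=
  ∃ c, ∀ m, ∃ p, ∀ i s, s m = a i →
    Runs p s ((N i + 2) ^ c) fun s' => s' m = f i ∧ ∀ x, x < m → s' x = s x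

section PolyBdd

variable {ι : Type} {N f g : ι → ℕ}

theorem PolyBdd.mono (hg : PolyBdd N g) (h : ∀ i, f i ≤ g i) : PolyBdd N f :=
  let ⟨c, hc⟩ := hg
  ⟨c, fun i => (h i).trans (hc i)⟩

/-- Uses `k ≤ 2^k`: the summand 2 keeps the base large enough to absorb constants, and sums, into
the exponent. -/
theorem PolyBdd.const (N : ι → ℕ) (k : ℕ) : PolyBdd N fun _ => k :=
  ⟨k, fun i => (Nat.lt_two_pow_self (n := k)).le.trans (Nat.pow_le_pow_left (by omega) k)⟩

theorem PolyBdd.add (hf : PolyBdd N f) (hg : PolyBdd N g) : PolyBdd N fun i => f i + g i := by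
  obtain ⟨c, hc⟩ := hf
  obtain ⟨d, hd⟩ := hg
  refine ⟨c + d + 1, fun i => ?_⟩
  have h1 := (hc i).trans (Nat.pow_le_pow_right (by omega) (Nat.le_add_right c d))
  have h2 := (hd i).trans (Nat.pow_le_pow_right (by omega) (Nat.le_add_left d c))
  rw [pow_succ]
  have : (N i + 2) ^ (c + d) * 2 ≤ (N i + 2) ^ (c + d) * (N i + 2) :=
    Nat.mul_le_mul_left _ (by omega)
  exact (Nat.add_le_add h1 h2).trans (by omega)

theorem PolyBdd.mul (hf : PolyBdd N f) (hg : PolyBdd N g) : PolyBdd N fun i => f i * g i := by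
  obtain ⟨c, hc⟩ := hf
  obtain ⟨d, hd⟩ := hg
  exact ⟨c + d, fun i => (Nat.mul_le_mul (hc i) (hd i)).trans (pow_add _ _ _).ge⟩

theorem PolyBdd.comap {κ : Type} (h : PolyBdd N f) (g : κ → ι) :
    PolyBdd (fun x => N (g x)) fun x => f (g x) :=
  let ⟨c, hc⟩ := h
  ⟨c, fun x => hc (g x)⟩

theorem PolyBdd.pow_self (N : ι → ℕ) (c : ℕ) : PolyBdd N fun i => (N i + 2) ^ c :=
  ⟨c, fun _ => le_rfl⟩

end PolyBdd

section Feas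

variable {ι κ : Type} {N : ι → ℕ} {a b f g : ι → Data}

/-- A program whose time is polynomially bounded witnesses feasibility. -/
theorem Feas.of_runs {T : ι → ℕ} (hT : PolyBdd N T)
    (h : ∀ m, ∃ p, ∀ i s, s m = a i →
      Runs p s (T i) fun s' => s' m = f i ∧ ∀ x, x < m → s' x = s x) : Feas N a f := by
  obtain ⟨c, hc⟩ := hT
  refine ⟨c, fun m => ?_⟩
  obtain ⟨p, hp⟩ := h m
  exact ⟨p, fun i s hs => (hp i s hs).mono (hc i) fun _ h => h⟩

theorem Feas.comap (h : Feas N a f) (g : κ → ι) :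
    Feas (fun x => N (g x)) (fun x => a (g x)) fun x => f (g x) := by
  obtain ⟨c, hc⟩ := h
  refine ⟨c, fun m => ?_⟩
  obtain ⟨p, hp⟩ := hc m
  exact ⟨p, fun x => hp (g x)⟩

theorem Feas.congr (h : Feas N a f) (hfg : ∀ i, f i = g i) : Feas N a g :=
  (funext hfg : f = g) ▸ h

theorem Feas.refl (N : ι → ℕ) (a : ι → Data) : Feas N a a := by
  refine Feas.of_runs (PolyBdd.const N 2) fun m => ⟨.assign m (.var m), fun i s hs => ?_⟩
  refine Runs.assign ⟨by simp [Expr.eval, hs], fun x hx => ?_⟩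
  rw [Function.update_of_ne hx.ne]

theorem Feas.trans (h : Feas N a b) (h' : Feas N b f) : Feas N a f := by
  obtain ⟨c, hc⟩ := h
  obtain ⟨d, hd⟩ := h'
  refine Feas.of_runs ((PolyBdd.pow_self N c).add (PolyBdd.pow_self N d)) fun m => ?_
  obtain ⟨p, hp⟩ := hc m
  obtain ⟨q, hq⟩ := hd m
  refine ⟨.seq p q, fun i s hs => (hp i s hs).seq fun s' ⟨h1, h2⟩ => ?_⟩
  exact (hq i s' h1).mono le_rfl fun s'' ⟨h3, h4⟩ => ⟨h3, fun x hx => (h4 x hx).trans (h2 x hx)⟩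

theorem Feas.nil (N : ι → ℕ) (a : ι → Data) : Feas N a fun _ => .nil := by
  refine Feas.of_runs (PolyBdd.const N 2) fun m => ⟨.assign m .nil, fun i s hs => ?_⟩
  refine Runs.assign ⟨by simp [Expr.eval], fun x hx => ?_⟩
  rw [Function.update_of_ne hx.ne]

theorem Feas.hd (h : Feas N a f) : Feas N a fun i => (f i).hd := by
  refine h.trans ?_
  refine Feas.of_runs (PolyBdd.const N 3) fun m => ⟨.assign m (.hd (.var m)), fun i s hs => ?_⟩
  refine Runs.assign ⟨by simp [Expr.eval, hs], fun x hx => ?_⟩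
  rw [Function.update_of_ne hx.ne]

theorem Feas.tl (h : Feas N a f) : Feas N a fun i => (f i).tl := by
  refine h.trans ?_
  refine Feas.of_runs (PolyBdd.const N 3) fun m => ⟨.assign m (.tl (.var m)), fun i s hs => ?_⟩
  refine Runs.assign ⟨by simp [Expr.eval, hs], fun x hx => ?_⟩
  rw [Function.update_of_ne hx.ne]

/-- A computation run in a higher variable, keeping the input. -/
theorem Feas.exists_prog (h : Feas N a f) : ∃ c, ∀ m r, m < r → ∃ p, ∀ i s, s m = a i →
    Runs p s ((N i + 2) ^ c) fun s' => s' r = f i ∧ ∀ x, x < r → s' x = s x := by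
  obtain ⟨c, hc⟩ := h
  obtain ⟨d, hd⟩ := (PolyBdd.const N 2).add (PolyBdd.pow_self N c)
  refine ⟨d, fun m r hr => ?_⟩
  obtain ⟨p, hp⟩ := hc r
  refine ⟨.seq (.assign r (.var m)) p, fun i s hs => ?_⟩
  refine Runs.mono (Runs.seq (Runs.assign (Q := fun s' => s' r = a i ∧ ∀ x, x < r → s' x = s x)
    ⟨by simp [Expr.eval, hs], fun x hx => Function.update_of_ne hx.ne _ _⟩) fun s' ⟨h1, h2⟩ =>
      (hp i s' h1).mono le_rfl fun s'' ⟨h3, h4⟩ =>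
        ⟨h3, fun x hx => (h4 x hx).trans (h2 x hx)⟩) (hd i) fun s'' h => h

theorem Feas.cons (hf : Feas N a f) (hg : Feas N a g) : Feas N a fun i => .cons (f i) (g i) := by
  obtain ⟨c, hc⟩ := hf.exists_prog
  obtain ⟨d, hd⟩ := hg.exists_prog
  refine Feas.of_runs (((PolyBdd.pow_self N c).add (PolyBdd.pow_self N d)).add
    (PolyBdd.const N 4)) fun m => ?_
  obtain ⟨p, hp⟩ := hc m (m + 1) (by omega)
  obtain ⟨q, hq⟩ := hd m (m + 2) (by omega)
  refine ⟨.seq (.seq p q) (.assign m (.cons (.var (m + 1)) (.var (m + 2)))), fun i s hs => ?_⟩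
  refine ((hp i s hs).seq fun s₁ ⟨h1, h2⟩ =>
    (hq i s₁ ((h2 m (by omega)).trans hs)).mono le_rfl (R := fun s₂ => s₂ (m + 1) = f i ∧
      s₂ (m + 2) = g i ∧ ∀ x, x < m → s₂ x = s x) fun s₂ ⟨h3, h4⟩ =>
        ⟨(h4 _ (by omega)).trans h1, h3, fun x hx => (h4 x (by omega)).trans (h2 x (by omega))⟩).seq
    fun s₂ ⟨h1, h2, h3⟩ => Runs.assign ⟨by simp [Expr.eval, h1, h2], fun x hx => ?_⟩
  rw [Function.update_of_ne hx.ne, h3 x hx]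

open Classical in
/-- Branching on a computed value. -/
theorem Feas.cond {t : ι → Data} (ht : Feas N a t) (hf : Feas N a f) (hg : Feas N a g) :
    Feas N a fun i => if t i = .nil then g i else f i := by
  obtain ⟨c, hc⟩ := ht.exists_prog
  obtain ⟨d, hd⟩ := hf
  obtain ⟨e, he⟩ := hg
  refine Feas.of_runs ((PolyBdd.pow_self N c).add ((PolyBdd.const N 2).add
    ((PolyBdd.pow_self N d).add (PolyBdd.pow_self N e)))) fun m => ?_
  obtain ⟨p, hp⟩ := hc m (m + 1) (by omega)
  obtain ⟨q, hq⟩ := hd m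
  obtain ⟨r, hr⟩ := he m
  refine ⟨.seq p (.ite (.var (m + 1)) q r), fun i s hs => (hp i s hs).seq fun s₁ ⟨h1, h2⟩ =>
    Runs.ite (fun h => ?_) fun h => ?_⟩
  · refine (hq i s₁ ((h2 m (by omega)).trans hs)).mono (by omega) fun s₂ ⟨h3, h4⟩ =>
      ⟨?_, fun x hx => (h4 x hx).trans (h2 x (by omega))⟩
    simp only [Expr.eval, h1] at h
    rw [if_neg h, h3]
  · refine (hr i s₁ ((h2 m (by omega)).trans hs)).mono (by omega) fun s₂ ⟨h3, h4⟩ =>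
      ⟨?_, fun x hx => (h4 x hx).trans (h2 x (by omega))⟩
    simp only [Expr.eval, h1] at h
    rw [if_pos h, h3]

/-- Iterating over a computed list with an accumulator. -/
theorem Feas.fold {l : ι → List Data} {A : ι → ℕ → Data} (hlen : PolyBdd N fun i => (l i).length)
    (hl : Feas N a fun i => Data.ofList (l i)) (h0 : Feas N a fun i => A i 0)
    (hstep : Feas (ι := Σ i, Fin (l i).length) (fun x => N x.1)
      (fun x => .cons ((l x.1).get x.2) (.cons (A x.1 x.2) (a x.1)))
      fun x => A x.1 (x.2 + 1)) :
    Feas N a fun i => A i (l i).length := by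
  obtain ⟨c, hc⟩ := hl.exists_prog
  obtain ⟨d, hd⟩ := h0.exists_prog
  obtain ⟨e, he⟩ := hstep
  refine Feas.of_runs (T := fun i => ((N i + 2) ^ c + (N i + 2) ^ d) +
    (((l i).length * (2 + (7 + ((N i + 2) ^ e + 5))) + 2) + 2)) ?_ fun m => ?_
  · exact ((PolyBdd.pow_self N c).add (PolyBdd.pow_self N d)).add
      (((hlen.mul ((PolyBdd.const N 2).add ((PolyBdd.const N 7).add
        ((PolyBdd.pow_self N e).add (PolyBdd.const N 5))))).add (PolyBdd.const N 2)).add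
          (PolyBdd.const N 2))
  obtain ⟨p, hp⟩ := hc m (m + 1) (by omega)
  obtain ⟨q, hq⟩ := hd m (m + 2) (by omega)
  obtain ⟨r, hr⟩ := he (m + 3)
  refine ⟨.seq (.seq p q) (.seq (.loop (.var (m + 1)) (.seq (.assign (m + 3)
    (.cons (.hd (.var (m + 1))) (.cons (.var (m + 2)) (.var m)))) (.seq r
      (.seq (.assign (m + 2) (.var (m + 3))) (.assign (m + 1) (.tl (.var (m + 1))))))))
    (.assign m (.var (m + 2)))), fun i s hs => ?_⟩
  -- The invariant is indexed by the number `j` of entries still to be processed. Variable `m` keeps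
  -- the input, `m + 1` the remaining list, `m + 2` the accumulator; `m + 3` is where the step runs.
  let I : ℕ → Store → Prop := fun j s' => s' m = a i ∧
    s' (m + 1) = Data.ofList ((l i).drop ((l i).length - j)) ∧
    s' (m + 2) = A i ((l i).length - j) ∧ ∀ x, x < m → s' x = s x
  refine Runs.seq (Q := I (l i).length) ?_ fun s₁ hs₁ => Runs.seq (Q := I 0)
    (Runs.loop (T := 7 + ((N i + 2) ^ e + 5)) I hs₁ ?_ ?_) fun s₂ hs₂ => ?_
  · refine (hp i s hs).seq fun s₁ ⟨h1, h2⟩ =>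
      (hq i s₁ ((h2 m (by omega)).trans hs)).mono le_rfl fun s₂ ⟨h3, h4⟩ => ⟨?_, ?_, ?_, ?_⟩
    · rw [h4 _ (by omega), h2 _ (by omega), hs]
    · rw [h4 _ (by omega), h1]; simp
    · rw [h3]; simp
    · intro x hx
      rw [h4 _ (by omega), h2 _ (by omega)]
  · intro s' h
    refine ⟨?_, h⟩
    have := h.2.1
    simpa [Expr.eval, Data.ofList] using this
  · rintro j hj s' ⟨h1, h2, h3, h4⟩
    have hlt : (l i).length - (j + 1) < (l i).length := by omega
    have hsucc : (l i).length - (j + 1) + 1 = (l i).length - j := by omega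
    rw [List.drop_eq_getElem_cons hlt, hsucc] at h2
    refine ⟨by simp [Expr.eval, h2, Data.ofList], ?_⟩
    refine Runs.seq (Q := fun s₁ => s₁ (m + 3) = .cons ((l i).get ⟨_, hlt⟩)
      (.cons (A i ((l i).length - (j + 1))) (a i)) ∧ ∀ x, x < m + 3 → s₁ x = s' x)
      (Runs.assign ⟨?_, fun x hx => Function.update_of_ne hx.ne _ _⟩) fun s₁ ⟨h5, h6⟩ =>
        Runs.seq (hr ⟨i, ⟨_, hlt⟩⟩ s₁ h5) fun s₂ ⟨h7, h8⟩ =>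
          Runs.seq (T := 2) (T' := 3) (Runs.assign (Q := fun s₃ => s₃ (m + 2) = A i ((l i).length - j) ∧
            ∀ x, x < m + 2 → s₃ x = s' x) ⟨?_, fun x hx => ?_⟩) fun s₃ ⟨h9, h10⟩ =>
              Runs.assign ⟨?_, ?_, ?_, fun x hx => ?_⟩
    · simp [Expr.eval, h1, h2, h3, Data.ofList, Data.hd]
    · simp only [Expr.eval, Function.update_self, h7, hsucc]
    · rw [Function.update_of_ne hx.ne, h8 x (by omega), h6 x (by omega)]
    · rw [Function.update_of_ne (by omega), h10 m (by omega), h1]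
    · simp only [Expr.eval, Function.update_self, h10 (m + 1) (by omega), h2, Data.ofList, Data.tl]
    · rw [Function.update_of_ne (by omega), h9]
    · rw [Function.update_of_ne (by omega), h10 x (by omega), h4 x hx]
  · refine Runs.assign ⟨?_, fun x hx => ?_⟩
    · simpa [Expr.eval] using hs₂.2.2.1
    · rw [Function.update_of_ne hx.ne, hs₂.2.2.2 x hx]

end Feas

/-! ### List operations, with local variables consed onto the input as an environment -/

section Lists

variable {ι : Type} {N : ι → ℕ} {a : ι → Data}

/-- A computation remains available below a new local variable. -/
theorem Feas.up {κ : Type} {N' : κ → ℕ} {b : κ → Data} {f : ι → Data} (h : Feas N a f)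
    {g : κ → ι} {v : κ → Data} (hN : ∀ x, N (g x) = N' x) (hb : ∀ x, b x = .cons (v x) (a (g x))) :
    Feas N' b fun x => f (g x) := by
  obtain rfl : (fun x => N (g x)) = N' := funext hN
  obtain rfl : b = fun x => .cons (v x) (a (g x)) := funext hb
  exact (Feas.refl _ _).tl.trans (h.comap g)

theorem Feas.up₁ {β : ι → Type} {f : ι → Data} (h : Feas N a f) (v : (Σ i, β i) → Data) :
    Feas (ι := Σ i, β i) (fun x => N x.1) (fun x => .cons (v x) (a x.1)) fun x => f x.1 :=
  h.up (fun _ => rfl) fun _ => rfl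

theorem Feas.top (N : ι → ℕ) (v b : ι → Data) : Feas N (fun x => .cons (v x) (b x)) v :=
  (Feas.refl _ _).hd

/-- Folding a typed step function over a computed list; the step only has to be feasible for the
accumulators satisfying an invariant. -/
theorem Feas.foldl_of_inv {β σ : ι → Type} {L : ∀ i, List (β i)} {eβ : ∀ i, β i → Data}
    {eσ : ∀ i, σ i → Data} {init : ∀ i, σ i} {step : ∀ i, σ i → β i → σ i}
    (Inv : ∀ i, σ i → Prop) (hInv : ∀ i j, Inv i (((L i).take j).foldl (step i) (init i)))
    (hlen : PolyBdd N fun i => (L i).length)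
    (hL : Feas N a fun i => Data.ofList ((L i).map (eβ i)))
    (hinit : Feas N a fun i => eσ i (init i))
    (hstep : Feas (ι := Σ i, {s : σ i // Inv i s} × β i) (fun x => N x.1)
      (fun x => .cons (eβ x.1 x.2.2) (.cons (eσ x.1 x.2.1) (a x.1)))
      fun x => eσ x.1 (step x.1 x.2.1 x.2.2)) :
    Feas N a fun i => eσ i ((L i).foldl (step i) (init i)) := by
  have h := Feas.fold (N := N) (a := a) (l := fun i => (L i).map (eβ i))
    (A := fun i j => eσ i (((L i).take j).foldl (step i) (init i)))
    (hlen.mono fun i => by simp) hL (by simpa using hinit) ?_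
  · exact h.congr fun i => by simp
  · have := hstep.comap (κ := Σ i, Fin ((L i).map (eβ i)).length) fun x =>
      ⟨x.1, ⟨_, hInv x.1 x.2⟩, (L x.1)[(x.2 : ℕ)]'(by simpa using x.2.2)⟩
    convert this using 2 with x x
    · simp
    · obtain ⟨i, j, hj⟩ := x
      have hj : j < (L i).length := by simpa using hj
      simp only [List.take_succ_eq_append_getElem hj, List.foldl_append]
      rfl

theorem Feas.foldl {β σ : ι → Type} {L : ∀ i, List (β i)} {eβ : ∀ i, β i → Data}
    {eσ : ∀ i, σ i → Data} {init : ∀ i, σ i} {step : ∀ i, σ i → β i → σ i}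
    (hlen : PolyBdd N fun i => (L i).length)
    (hL : Feas N a fun i => Data.ofList ((L i).map (eβ i)))
    (hinit : Feas N a fun i => eσ i (init i))
    (hstep : Feas (ι := Σ i, σ i × β i) (fun x => N x.1)
      (fun x => .cons (eβ x.1 x.2.2) (.cons (eσ x.1 x.2.1) (a x.1)))
      fun x => eσ x.1 (step x.1 x.2.1 x.2.2)) :
    Feas N a fun i => eσ i ((L i).foldl (step i) (init i)) :=
  Feas.foldl_of_inv (fun _ _ => True) (fun _ _ => trivial) hlen hL hinit
    (hstep.comap fun x : Σ i, {_s : σ i // True} × β i => ⟨x.1, x.2.1.1, x.2.2⟩)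

/-- Iterating a function as often as a computed list is long. -/
theorem Feas.iterate {β σ : ι → Type} {L : ∀ i, List (β i)} {eβ : ∀ i, β i → Data}
    {eσ : ∀ i, σ i → Data} {init : ∀ i, σ i} {f : ∀ i, σ i → σ i}
    (hlen : PolyBdd N fun i => (L i).length)
    (hL : Feas N a fun i => Data.ofList ((L i).map (eβ i)))
    (hinit : Feas N a fun i => eσ i (init i))
    (hstep : Feas (ι := Σ i, σ i) (fun x => N x.1) (fun x => .cons (eσ x.1 x.2) (a x.1))
      fun x => eσ x.1 (f x.1 x.2)) :
    Feas N a fun i => eσ i ((f i)^[(L i).length] (init i)) := by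
  refine (Feas.foldl (step := fun i s _ => f i s) hlen hL hinit ?_).congr fun i => ?_
  · exact (hstep.comap fun x : Σ i, σ i × β i => ⟨x.1, x.2.1⟩).up (fun _ => rfl) fun _ => rfl
  · congr 1
    generalize init i = s
    induction L i generalizing s with
    | nil => rfl
    | cons x l ih => simpa using ih (f i s)

theorem Feas.reverse {β : ι → Type} {L : ∀ i, List (β i)} {e : ∀ i, β i → Data}
    (hlen : PolyBdd N fun i => (L i).length)
    (hL : Feas N a fun i => Data.ofList ((L i).map (e i))) :
    Feas N a fun i => Data.ofList ((L i).reverse.map (e i)) := by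
  refine (Feas.foldl (σ := fun i => List (β i)) (eσ := fun i l => Data.ofList (l.map (e i)))
    (init := fun _ => []) (step := fun _ l x => x :: l) hlen hL (Feas.nil _ _) ?_).congr fun i => ?_
  · exact (Feas.refl _ _).hd.cons (Feas.refl _ _).tl.hd
  · rw [List.foldl_flip_cons_eq_append']
    simp

theorem Feas.append {β : ι → Type} {L L' : ∀ i, List (β i)} {e : ∀ i, β i → Data}
    (hlen : PolyBdd N fun i => (L i).length)
    (hL : Feas N a fun i => Data.ofList ((L i).map (e i)))
    (hL' : Feas N a fun i => Data.ofList ((L' i).map (e i))) :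
    Feas N a fun i => Data.ofList ((L i ++ L' i).map (e i)) := by
  refine (Feas.foldl (σ := fun i => List (β i)) (eσ := fun i l => Data.ofList (l.map (e i)))
    (init := fun i => L' i) (step := fun _ l x => x :: l) (L := fun i => (L i).reverse)
    (hlen.mono fun _ => by simp) (hL.reverse hlen) hL' ?_).congr fun i => ?_
  · exact (Feas.refl _ _).hd.cons (Feas.refl _ _).tl.hd
  · rw [List.foldl_flip_cons_eq_append']
    simp

theorem Feas.flatMap {β γ : ι → Type} {L : ∀ i, List (β i)} {e : ∀ i, β i → Data}
    {F : ∀ i, β i → List (γ i)} {e' : ∀ i, γ i → Data}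
    (hlen : PolyBdd N fun i => (L i).length)
    (hlen' : PolyBdd (ι := Σ i, β i) (fun x => N x.1) fun x => (F x.1 x.2).length)
    (hL : Feas N a fun i => Data.ofList ((L i).map (e i)))
    (hF : Feas (ι := Σ i, β i) (fun x => N x.1) (fun x => .cons (e x.1 x.2) (a x.1))
      fun x => Data.ofList ((F x.1 x.2).map (e' x.1))) :
    Feas N a fun i => Data.ofList (((L i).flatMap (F i)).map (e' i)) := by
  -- Each block is prepended to the accumulator, so the list is processed in reverse to preserve
  -- order.
  refine (Feas.foldl (σ := fun i => List (γ i)) (eσ := fun i l => Data.ofList (l.map (e' i)))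
    (init := fun _ => []) (step := fun i l x => F i x ++ l) (L := fun i => (L i).reverse)
    (hlen.mono fun _ => by simp) (hL.reverse hlen) (Feas.nil _ _) ?_).congr fun i => ?_
  · refine Feas.append (e := fun x : Σ i, List (γ i) × β i => e' x.1)
      (hlen'.comap fun x : Σ i, List (γ i) × β i => ⟨x.1, x.2.2⟩) ?_ (Feas.refl _ _).tl.hd
    exact ((Feas.refl _ _).hd.cons (Feas.refl _ _).tl.tl).trans
      (hF.comap fun x : Σ i, List (γ i) × β i => ⟨x.1, x.2.2⟩)
  · congr 2
    rw [List.foldl_reverse]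
    induction L i with
    | nil => rfl
    | cons x l ih => simp [ih]

theorem Feas.map {β γ : ι → Type} {L : ∀ i, List (β i)} {e : ∀ i, β i → Data}
    {F : ∀ i, β i → γ i} {e' : ∀ i, γ i → Data}
    (hlen : PolyBdd N fun i => (L i).length)
    (hL : Feas N a fun i => Data.ofList ((L i).map (e i)))
    (hF : Feas (ι := Σ i, β i) (fun x => N x.1) (fun x => .cons (e x.1 x.2) (a x.1))
      fun x => e' x.1 (F x.1 x.2)) :
    Feas N a fun i => Data.ofList (((L i).map (F i)).map (e' i)) := by
  refine (Feas.flatMap (F := fun i x => [F i x]) (e' := e') hlen (PolyBdd.const _ 1) hL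
    (hF.cons (Feas.nil _ _))).congr fun i => ?_
  rw [← List.map_eq_flatMap]

end Lists

/-! ### Truth values -/

section Bool

variable {ι : Type} {N : ι → ℕ} {a : ι → Data} {P Q : ι → Prop}

theorem ofProp_of_true {P : Prop} (h : P) : Data.ofProp P = .cons .nil .nil := if_pos h

theorem ofProp_of_false {P : Prop} (h : ¬ P) : Data.ofProp P = .nil := if_neg h

theorem Feas.iff (h : Feas N a fun i => Data.ofProp (P i)) (hPQ : ∀ i, P i ↔ Q i) :
    Feas N a fun i => Data.ofProp (Q i) :=
  h.congr fun i => by rw [hPQ i]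

open Classical in
theorem Feas.ite {f g : ι → Data} (hP : Feas N a fun i => Data.ofProp (P i)) (hf : Feas N a f)
    (hg : Feas N a g) : Feas N a fun i => if P i then f i else g i :=
  (hP.cond hf hg).congr fun i => by
    by_cases h : P i
    · rw [if_neg (by simp [ofProp_of_true h]), if_pos h]
    · rw [if_pos (ofProp_of_false h), if_neg h]

theorem Feas.true (N : ι → ℕ) (a : ι → Data) : Feas N a fun _ => .cons .nil .nil :=
  (Feas.nil N a).cons (Feas.nil N a)

theorem Feas.ne_nil {f : ι → Data} (hf : Feas N a f) :
    Feas N a fun i => Data.ofProp (f i ≠ .nil) :=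
  (hf.cond (Feas.true N a) (Feas.nil N a)).congr fun i => by
    by_cases h : f i = .nil
    · simp [h, ofProp_of_false]
    · simp [h, ofProp_of_true]

theorem Feas.not (hP : Feas N a fun i => Data.ofProp (P i)) :
    Feas N a fun i => Data.ofProp (¬ P i) :=
  (hP.cond (Feas.nil N a) (Feas.true N a)).congr fun i => by
    by_cases h : P i
    · simp [ofProp_of_true h, ofProp_of_false (not_not.2 h)]
    · simp [ofProp_of_false h, ofProp_of_true h]

theorem Feas.and (hP : Feas N a fun i => Data.ofProp (P i))
    (hQ : Feas N a fun i => Data.ofProp (Q i)) : Feas N a fun i => Data.ofProp (P i ∧ Q i) :=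
  (hP.ite hQ (Feas.nil N a)).congr fun i => by
    by_cases h : P i
    · simp [h]
    · simp [h, ofProp_of_false]

theorem Feas.or (hP : Feas N a fun i => Data.ofProp (P i))
    (hQ : Feas N a fun i => Data.ofProp (Q i)) : Feas N a fun i => Data.ofProp (P i ∨ Q i) :=
  (hP.not.and hQ.not).not.iff fun i => by tauto

theorem Feas.imp (hP : Feas N a fun i => Data.ofProp (P i))
    (hQ : Feas N a fun i => Data.ofProp (Q i)) : Feas N a fun i => Data.ofProp (P i → Q i) :=
  (hP.not.or hQ).iff fun i => by tauto

theorem Feas.exists_mem {β : ι → Type} {L : ∀ i, List (β i)} {e : ∀ i, β i → Data}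
    {R : ∀ i, β i → Prop} (hlen : PolyBdd N fun i => (L i).length)
    (hL : Feas N a fun i => Data.ofList ((L i).map (e i)))
    (hR : Feas (ι := Σ i, β i) (fun x => N x.1) (fun x => .cons (e x.1 x.2) (a x.1))
      fun x => Data.ofProp (R x.1 x.2)) :
    Feas N a fun i => Data.ofProp (∃ x ∈ L i, R i x) := by
  refine (Feas.foldl (σ := fun _ => Prop) (eσ := fun _ p => Data.ofProp p)
    (init := fun _ => False) (step := fun i p x => p ∨ R i x) hlen hL
    ((Feas.nil _ _).congr fun _ => (ofProp_of_false id).symm) ?_).iff fun i => ?_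
  · refine Feas.or (Feas.refl _ _).tl.hd ?_
    exact ((Feas.refl _ _).hd.cons (Feas.refl _ _).tl.tl).trans
      (hR.comap fun x : Σ i, Prop × β i => ⟨x.1, x.2.2⟩)
  · have : ∀ p : Prop, (L i).foldl (fun p x => p ∨ R i x) p ↔ p ∨ ∃ x ∈ L i, R i x := by
      induction L i with
      | nil => simp
      | cons x l ih =>
        intro p
        rw [List.foldl_cons, ih]
        simp [or_assoc]
    simpa using this False

end Bool

/-! ### Numbers -/

section Numbers

variable {ι : Type} {N : ι → ℕ} {a : ι → Data} {m m' : ι → ℕ}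

theorem ofNat_tl (m : ℕ) : (Data.ofNat m).tl = Data.ofNat (m - 1) := by
  cases m <;> rfl

theorem ofNat_ne_nil {m : ℕ} : Data.ofNat m ≠ .nil ↔ 0 < m := by
  cases m <;> simp [Data.ofNat, Data.ofList, List.replicate_succ]

theorem Feas.succ (h : Feas N a fun i => Data.ofNat (m i)) :
    Feas N a fun i => Data.ofNat (m i + 1) :=
  (Feas.nil N a).cons h

theorem Feas.pred (h : Feas N a fun i => Data.ofNat (m i)) :
    Feas N a fun i => Data.ofNat (m i - 1) :=
  h.tl.congr fun _ => ofNat_tl _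

theorem Feas.iterate_ofNat {σ : ι → Type} {eσ : ∀ i, σ i → Data} {init : ∀ i, σ i}
    {f : ∀ i, σ i → σ i} (hm : PolyBdd N m) (h : Feas N a fun i => Data.ofNat (m i))
    (hinit : Feas N a fun i => eσ i (init i))
    (hstep : Feas (ι := Σ i, σ i) (fun x => N x.1) (fun x => .cons (eσ x.1 x.2) (a x.1))
      fun x => eσ x.1 (f x.1 x.2)) :
    Feas N a fun i => eσ i ((f i)^[m i] (init i)) := by
  refine (Feas.iterate (β := fun _ => Unit) (L := fun i => List.replicate (m i) ())
    (eβ := fun _ _ => .nil) (hm.mono fun i => by simp) (h.congr fun i => ?_) hinit hstep).congr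
      fun i => by simp
  rw [List.map_replicate]
  rfl

theorem Feas.add (hm : PolyBdd N m) (h : Feas N a fun i => Data.ofNat (m i))
    (h' : Feas N a fun i => Data.ofNat (m' i)) : Feas N a fun i => Data.ofNat (m i + m' i) := by
  refine (Feas.iterate_ofNat (σ := fun _ => ℕ) (eσ := fun _ => Data.ofNat) (init := m')
    (f := fun _ => Nat.succ) hm h h' (Feas.refl _ _).hd.succ).congr fun i => ?_
  rw [Nat.succ_iterate, add_comm]

theorem Feas.sub (hm : PolyBdd N m) (h : Feas N a fun i => Data.ofNat (m i))
    (h' : Feas N a fun i => Data.ofNat (m' i)) : Feas N a fun i => Data.ofNat (m' i - m i) := by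
  refine (Feas.iterate_ofNat (σ := fun _ => ℕ) (eσ := fun _ => Data.ofNat) (init := m')
    (f := fun _ => Nat.pred) hm h h' (Feas.refl _ _).hd.pred).congr fun i => ?_
  rw [Nat.pred_iterate]

theorem Feas.lt (hm : PolyBdd N m) (h : Feas N a fun i => Data.ofNat (m i))
    (h' : Feas N a fun i => Data.ofNat (m' i)) :
    Feas N a fun i => Data.ofProp (m i < m' i) :=
  (h.sub hm h').ne_nil.iff fun _ => by rw [ofNat_ne_nil]; omega

theorem Feas.le (hm' : PolyBdd N m') (h : Feas N a fun i => Data.ofNat (m i))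
    (h' : Feas N a fun i => Data.ofNat (m' i)) :
    Feas N a fun i => Data.ofProp (m i ≤ m' i) :=
  (h'.lt hm' h).not.iff fun i => by omega

theorem Feas.length {β : ι → Type} {L : ∀ i, List (β i)} {e : ∀ i, β i → Data}
    (hlen : PolyBdd N fun i => (L i).length)
    (hL : Feas N a fun i => Data.ofList ((L i).map (e i))) :
    Feas N a fun i => Data.ofNat (L i).length := by
  refine (Feas.iterate (σ := fun _ => ℕ) (eσ := fun _ => Data.ofNat) (init := fun _ => 0)
    (f := fun _ => Nat.succ) hlen hL (Feas.nil _ _) (Feas.refl _ _).hd.succ).congr fun i => ?_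
  rw [Nat.succ_iterate, zero_add]

end Numbers

/-! ### Graph computations -/

/-- The list of all vertices, in unary, is available. -/
structure HasVerts {ι : Type} (N : ι → ℕ) (a : ι → Data) (n : ι → ℕ) : Prop where
  bdd : PolyBdd N n
  feas : Feas N a fun i => Data.ofList ((List.finRange (n i)).map fun v : Fin (n i) => Data.ofNat v)

/-- A vertex set as the list of its membership bits. -/
noncomputable def Data.ofSet {n : ℕ} (S : Set (Fin n)) : Data :=
  Data.ofList (List.ofFn fun v => Data.ofProp (v ∈ S))

/-- One round of exploring the component of a vertex outside `S`. -/
def connStep {V : Type*} (G : SimpleGraph V) (S R : Set V) : Set V :=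
  {y | y ∈ R ∨ (y ∉ S ∧ ∃ x, x ∈ R ∧ x ∉ S ∧ G.Adj x y)}

/-- The reached set grows until it is stable, so as many rounds as there are vertices suffice; this
makes connectivity a bounded iteration. -/
theorem conn_iff_mem_iterate {V : Type*} [Finite V] (G : SimpleGraph V) (S : Set V) (c d : V) :
    Conn G S c d ↔ d ∈ (connStep G S)^[Nat.card V] {c} := by
  have hsub : ∀ R, R ⊆ connStep G S R := fun R x hx => Or.inl hx
  constructor
  · have hfix : connStep G S ((connStep G S)^[Nat.card V] {c}) =
        (connStep G S)^[Nat.card V] {c} :=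
      iterate_eq_of_rank _ Set.ncard (fun R hR => Set.ncard_lt_ncard
        (Set.ssubset_iff_subset_ne.2 ⟨hsub R, hR.symm⟩) (Set.toFinite _)) Set.ncard_le_card _
    intro h
    induction h with
    | refl =>
      exact Function.Iterate.rec (fun R : Set V => c ∈ R) (Set.mem_singleton c) (fun R h => hsub R h) _
    | tail _ h ih =>
      rw [← hfix]
      exact Or.inr ⟨h.2.2, _, ih, h.2.1, h.1⟩
  · refine Function.Iterate.rec (fun R : Set V => ∀ d, d ∈ R → Conn G S c d) ?_ ?_ _ d
    · rintro d rfl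
      exact Conn.refl _ _ _
    · rintro R h y (hy | ⟨hy, x, hx, hxS, hxy⟩)
      · exact h y hy
      · exact (h x hx).tail hxy hxS hy

section Graphs

variable {ι : Type} {N : ι → ℕ} {a : ι → Data} {n : ι → ℕ}

theorem HasVerts.up {β : ι → Type} (h : HasVerts N a n) (v : (Σ i, β i) → Data) :
    HasVerts (ι := Σ i, β i) (fun x => N x.1) (fun x => .cons (v x) (a x.1)) fun x => n x.1 :=
  ⟨h.bdd.comap _, h.feas.up₁ v⟩

/-- Binding a vertex variable. -/
theorem HasVerts.push (h : HasVerts N a n) :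
    HasVerts (ι := Σ i, Fin (n i)) (fun x => N x.1) (fun x => .cons (Data.ofNat x.2) (a x.1))
      fun x => n x.1 :=
  h.up _

theorem HasVerts.var (_ : HasVerts N a n) :
    Feas (ι := Σ i, Fin (n i)) (fun x => N x.1) (fun x => .cons (Data.ofNat x.2) (a x.1))
      fun x => Data.ofNat x.2 :=
  Feas.top _ _ _

theorem Feas.push {f : ι → Data} (h : Feas N a f) (_ : HasVerts N a n) :
    Feas (ι := Σ i, Fin (n i)) (fun x => N x.1) (fun x => .cons (Data.ofNat x.2) (a x.1))
      fun x => f x.1 :=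
  h.up₁ _

theorem Feas.tab {F : ∀ i, Fin (n i) → Data} (hV : HasVerts N a n)
    (hF : Feas (ι := Σ i, Fin (n i)) (fun x => N x.1) (fun x => .cons (Data.ofNat x.2) (a x.1))
      fun x => F x.1 x.2) : Feas N a fun i => Data.ofList (List.ofFn (F i)) := by
  refine (Feas.map (β := fun i => Fin (n i)) (L := fun i => List.finRange (n i))
    (e := fun _ v => Data.ofNat v) (γ := fun _ => Data) (e' := fun _ => id) (F := F) (hV.bdd.mono fun i => by simp)
    hV.feas hF).congr fun i => ?_
  rw [List.map_id, List.ofFn_eq_map]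

theorem Feas.get {F : ∀ i, Fin (n i) → Data} {v : ∀ i, Fin (n i)} (hV : HasVerts N a n)
    (hF : Feas N a fun i => Data.ofList (List.ofFn (F i)))
    (hv : Feas N a fun i => Data.ofNat (v i)) : Feas N a fun i => F i (v i) := by
  refine (Feas.iterate_ofNat (σ := fun _ => List Data) (eσ := fun _ => Data.ofList)
    (f := fun _ => List.tail) (hV.bdd.mono fun i => (v i).2.le) hv hF ?_).hd.congr fun i => ?_
  · exact (Feas.refl _ _).hd.tl.congr fun x => by
      obtain ⟨i, l⟩ := x
      cases l <;> rfl
  · have : (List.tail)^[(v i : ℕ)] (List.ofFn (F i)) = (List.ofFn (F i)).drop (v i) := by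
      generalize List.ofFn (F i) = l
      induction (v i : ℕ) generalizing l with
      | zero => rfl
      | succ m ih => rw [Function.iterate_succ_apply, ih, List.drop_tail]
    rw [this, List.drop_eq_getElem_cons (by simp)]
    simp [Data.ofList, Data.hd]

theorem Feas.exists {R : ∀ i, Fin (n i) → Prop} (hV : HasVerts N a n)
    (hR : Feas (ι := Σ i, Fin (n i)) (fun x => N x.1) (fun x => .cons (Data.ofNat x.2) (a x.1))
      fun x => Data.ofProp (R x.1 x.2)) : Feas N a fun i => Data.ofProp (∃ v, R i v) :=
  (Feas.exists_mem (β := fun i => Fin (n i)) (L := fun i => List.finRange (n i))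
    (e := fun _ v => Data.ofNat v) (R := R) (hV.bdd.mono fun i => by simp) hV.feas hR).iff fun i => by simp

theorem Feas.forall {R : ∀ i, Fin (n i) → Prop} (hV : HasVerts N a n)
    (hR : Feas (ι := Σ i, Fin (n i)) (fun x => N x.1) (fun x => .cons (Data.ofNat x.2) (a x.1))
      fun x => Data.ofProp (R x.1 x.2)) : Feas N a fun i => Data.ofProp (∀ v, R i v) :=
  (Feas.exists (R := fun i v => ¬ R i v) hV hR.not).not.iff fun i => by simp

theorem Feas.eq {v w : ∀ i, Fin (n i)} (hV : HasVerts N a n)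
    (hv : Feas N a fun i => Data.ofNat (v i)) (hw : Feas N a fun i => Data.ofNat (w i)) :
    Feas N a fun i => Data.ofProp (v i = w i) :=
  ((hv.le (hV.bdd.mono fun i => (w i).2.le) hw).and
    (hw.le (hV.bdd.mono fun i => (v i).2.le) hv)).iff fun i => by rw [Fin.ext_iff]; omega

theorem Feas.ofSet {S : ∀ i, Set (Fin (n i))} (hV : HasVerts N a n)
    (hS : Feas (ι := Σ i, Fin (n i)) (fun x => N x.1) (fun x => .cons (Data.ofNat x.2) (a x.1))
      fun x => Data.ofProp (x.2 ∈ S x.1)) : Feas N a fun i => Data.ofSet (S i) :=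
  Feas.tab hV hS

theorem Feas.mem {S : ∀ i, Set (Fin (n i))} {v : ∀ i, Fin (n i)} (hV : HasVerts N a n)
    (hS : Feas N a fun i => Data.ofSet (S i)) (hv : Feas N a fun i => Data.ofNat (v i)) :
    Feas N a fun i => Data.ofProp (v i ∈ S i) :=
  Feas.get hV hS hv

variable {G : ∀ i, SimpleGraph (Fin (n i))}

theorem Feas.ofGraph (hV : HasVerts N a n)
    (hG : Feas (ι := Σ x : Σ i, Fin (n i), Fin (n x.1)) (fun x => N x.1.1)
      (fun x => .cons (Data.ofNat x.2) (.cons (Data.ofNat x.1.2) (a x.1.1)))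
      fun x => Data.ofProp ((G x.1.1).Adj x.1.2 x.2)) : Feas N a fun i => Data.ofGraph (G i) :=
  Feas.tab hV (Feas.tab (hV.up _) hG)

theorem Feas.adj {v w : ∀ i, Fin (n i)} (hV : HasVerts N a n)
    (hG : Feas N a fun i => Data.ofGraph (G i)) (hv : Feas N a fun i => Data.ofNat (v i))
    (hw : Feas N a fun i => Data.ofNat (w i)) :
    Feas N a fun i => Data.ofProp ((G i).Adj (v i) (w i)) :=
  Feas.get hV (Feas.get hV hG hv) hw

theorem Feas.conn {S : ∀ i, Set (Fin (n i))} {c d : ∀ i, Fin (n i)} (hV : HasVerts N a n)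
    (hG : Feas N a fun i => Data.ofGraph (G i)) (hS : Feas N a fun i => Data.ofSet (S i))
    (hc : Feas N a fun i => Data.ofNat (c i)) (hd : Feas N a fun i => Data.ofNat (d i)) :
    Feas N a fun i => Data.ofProp (Conn (G i) (S i) (c i) (d i)) := by
  have h : Feas N a fun i =>
      Data.ofSet ((connStep (G i) (S i))^[(List.finRange (n i)).length] {c i}) := by
    refine Feas.iterate (σ := fun i => Set (Fin (n i))) (eσ := fun i R => Data.ofSet R)
      (f := fun i => connStep (G i) (S i)) (hV.bdd.mono fun i => by simp) hV.feas
      (Feas.ofSet hV (Feas.eq hV.push hV.var (hc.push hV))) ?_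
    have hV₁ := hV.up (β := fun i => Set (Fin (n i))) fun x => Data.ofSet x.2
    have hR := Feas.top (ι := Σ i, Set (Fin (n i))) (fun x => N x.1) (fun x => Data.ofSet x.2)
      fun x => a x.1
    have hG₁ := hG.up₁ (β := fun i => Set (Fin (n i))) fun x => Data.ofSet x.2
    have hS₁ := hS.up₁ (β := fun i => Set (Fin (n i))) fun x => Data.ofSet x.2
    refine Feas.ofSet hV₁ ?_
    have hV₂ := hV₁.push
    refine (Feas.mem hV₂ (hR.push hV₁) hV₁.var).or
      ((Feas.mem hV₂ (hS₁.push hV₁) hV₁.var).not.and (Feas.exists hV₂ ?_))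
    have hV₃ := hV₂.push
    exact (Feas.mem hV₃ ((hR.push hV₁).push hV₂) hV₂.var).and
      ((Feas.mem hV₃ ((hS₁.push hV₁).push hV₂) hV₂.var).not.and
        (Feas.adj hV₃ ((hG₁.push hV₁).push hV₂) hV₂.var (hV₁.var.push hV₂)))
  refine (Feas.mem hV h hd).iff fun i => ?_
  rw [conn_iff_mem_iterate, List.length_finRange, Nat.card_fin]

theorem Feas.sees {S : ∀ i, Set (Fin (n i))} {c x : ∀ i, Fin (n i)} (hV : HasVerts N a n)
    (hG : Feas N a fun i => Data.ofGraph (G i)) (hS : Feas N a fun i => Data.ofSet (S i))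
    (hc : Feas N a fun i => Data.ofNat (c i)) (hx : Feas N a fun i => Data.ofNat (x i)) :
    Feas N a fun i => Data.ofProp (Sees (G i) (S i) (c i) (x i)) :=
  Feas.exists hV ((Feas.conn hV.push (hG.push hV) (hS.push hV) (hc.push hV) hV.var).and
    (Feas.adj hV.push (hG.push hV) hV.var (hx.push hV)))

theorem Feas.closedNbhd {v : ∀ i, Fin (n i)} (hV : HasVerts N a n)
    (hG : Feas N a fun i => Data.ofGraph (G i)) (hv : Feas N a fun i => Data.ofNat (v i)) :
    Feas N a fun i => Data.ofSet (insert (v i) ((G i).neighborSet (v i))) :=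
  Feas.ofSet hV ((Feas.eq hV.push hV.var (hv.push hV)).or
    (Feas.adj hV.push (hG.push hV) (hv.push hV) hV.var))

theorem Feas.linked {v p q : ∀ i, Fin (n i)} (hV : HasVerts N a n)
    (hG : Feas N a fun i => Data.ofGraph (G i)) (hv : Feas N a fun i => Data.ofNat (v i))
    (hp : Feas N a fun i => Data.ofNat (p i)) (hq : Feas N a fun i => Data.ofNat (q i)) :
    Feas N a fun i => Data.ofProp (∃ c, c ∉ insert (v i) ((G i).neighborSet (v i)) ∧
      (G i).Adj (p i) c ∧ Sees (G i) (insert (v i) ((G i).neighborSet (v i))) c (q i)) := by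
  have hN := (Feas.closedNbhd hV hG hv).push hV
  exact Feas.exists hV ((Feas.mem hV.push hN hV.var).not.and
    ((Feas.adj hV.push (hG.push hV) (hp.push hV) hV.var).and
      (Feas.sees hV.push (hG.push hV) hN hV.var (hq.push hV))))

theorem Feas.lbStep_adj {p q : ∀ i, Fin (n i)} (hV : HasVerts N a n)
    (hG : Feas N a fun i => Data.ofGraph (G i)) (hp : Feas N a fun i => Data.ofNat (p i))
    (hq : Feas N a fun i => Data.ofNat (q i)) :
    Feas N a fun i => Data.ofProp ((lbStep (G i)).Adj (p i) (q i)) := by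
  have h : Feas N a fun i => Data.ofProp (∃ v, (G i).Adj v (p i) ∧ (G i).Adj v (q i) ∧
      ∃ c, c ∉ insert v ((G i).neighborSet v) ∧ (G i).Adj (p i) c ∧
        Sees (G i) (insert v ((G i).neighborSet v)) c (q i)) :=
    Feas.exists hV ((Feas.adj hV.push (hG.push hV) hV.var (hp.push hV)).and
      ((Feas.adj hV.push (hG.push hV) hV.var (hq.push hV)).and
        (Feas.linked hV.push (hG.push hV) hV.var (hp.push hV) (hq.push hV))))
  refine ((Feas.adj hV hG hp hq).or ((Feas.eq hV hp hq).not.and h)).iff fun i => ?_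
  refine or_congr_right (and_congr_right fun _ => exists_congr fun v => ?_)
  constructor
  · rintro ⟨h1, h2, c, hc, hpc, d, hcd, hdq⟩
    exact ⟨c, d, h1, h2, hc, hpc, hcd, hdq⟩
  · rintro ⟨c, d, h1, h2, hc, hpc, hcd, hdq⟩
    exact ⟨h1, h2, c, hc, hpc, d, hcd, hdq⟩

theorem Feas.lbStep (hV : HasVerts N a n) (hG : Feas N a fun i => Data.ofGraph (G i)) :
    Feas N a fun i => Data.ofGraph (lbStep (G i)) :=
  Feas.ofGraph hV (Feas.lbStep_adj hV.push.push ((hG.push hV).push hV.push) (hV.var.push hV.push)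
    hV.push.var)

theorem Feas.lbClosure (hV : HasVerts N a n) (hG : Feas N a fun i => Data.ofGraph (G i)) :
    Feas N a fun i => Data.ofGraph (lbClosure (G i)) := by
  have hlen : PolyBdd N fun i => (List.finRange (n i)).length := hV.bdd.mono fun i => by simp
  refine (Feas.iterate (σ := fun i => SimpleGraph (Fin (n i))) (eσ := fun _ => Data.ofGraph)
    (f := fun i => (FillIn.lbStep)^[(List.finRange (n i)).length]) hlen hV.feas hG ?_).congr
      fun i => ?_
  · refine Feas.iterate (σ := fun x => SimpleGraph (Fin (n x.1))) (eσ := fun _ => Data.ofGraph)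
      (f := fun _ => FillIn.lbStep) (hlen.comap _) (hV.up _).feas (Feas.top _ _ _) ?_
    exact Feas.lbStep ((hV.up (β := fun i => SimpleGraph (Fin (n i))) fun x =>
      Data.ofGraph x.2).up (β := fun x => SimpleGraph (Fin (n x.1))) fun x => Data.ofGraph x.2)
      (Feas.top _ _ _)
  · rw [FillIn.lbClosure, List.length_finRange, Nat.card_fin]

theorem Feas.isolate {T : ∀ i, Set (Fin (n i))} (hV : HasVerts N a n)
    (hG : Feas N a fun i => Data.ofGraph (G i)) (hT : Feas N a fun i => Data.ofSet (T i)) :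
    Feas N a fun i => Data.ofGraph (isolate (G i) (T i)) := by
  have hV₂ := hV.push.push
  have hT₂ := (hT.push hV).push hV.push
  have hp := hV.var.push hV.push
  have hq := hV.push.var
  exact Feas.ofGraph hV ((Feas.adj hV₂ ((hG.push hV).push hV.push) hp hq).and
    ((Feas.mem hV₂ hT₂ hp).not.and (Feas.mem hV₂ hT₂ hq).not))

theorem Feas.pmcCond {S : ∀ i, Set (Fin (n i))} (hV : HasVerts N a n)
    (hG : Feas N a fun i => Data.ofGraph (G i)) (hS : Feas N a fun i => Data.ofSet (S i)) :
    Feas N a fun i => Data.ofProp (PMCCond (G i) (S i)) := by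
  have hV₁ := hV.push
  have hS₁ := hS.push hV
  have hV₂ := hV₁.push
  have hS₂ := hS₁.push hV₁
  have hG₂ := (hG.push hV).push hV₁
  have hx := hV.var.push hV₁
  have hy := hV₁.var
  refine Feas.and (Feas.forall hV ((Feas.mem hV₁ hS₁ hV.var).not.imp (Feas.exists hV₁
    ((Feas.mem hV₂ hS₂ hy).and (Feas.sees hV₂ hG₂ hS₂ hx hy).not)))) ?_
  refine Feas.forall hV ((Feas.mem hV₁ hS₁ hV.var).imp (Feas.forall hV₁
    ((Feas.mem hV₂ hS₂ hy).imp ((Feas.eq hV₂ hx hy).not.imp ((Feas.adj hV₂ hG₂ hx hy).not.imp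
      (Feas.exists hV₂ ((Feas.mem hV₂.push (hS₂.push hV₂) hV₂.var).not.and ?_)))))))
  exact (Feas.sees hV₂.push (hG₂.push hV₂) (hS₂.push hV₂) hV₂.var (hx.push hV₂)).and
    (Feas.sees hV₂.push (hG₂.push hV₂) (hS₂.push hV₂) hV₂.var (hy.push hV₂))

end Graphs

/-! ### Filtering and removal of repetitions -/

section Lists

variable {ι : Type} {N : ι → ℕ} {a : ι → Data}

theorem Feas.filter {β : ι → Type} {L : ∀ i, List (β i)} {e : ∀ i, β i → Data}
    {P : ∀ i, β i → Prop} [∀ i x, Decidable (P i x)] (hlen : PolyBdd N fun i => (L i).length)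
    (hL : Feas N a fun i => Data.ofList ((L i).map (e i)))
    (hP : Feas (ι := Σ i, β i) (fun x => N x.1) (fun x => .cons (e x.1 x.2) (a x.1))
      fun x => Data.ofProp (P x.1 x.2)) :
    Feas N a fun i => Data.ofList (((L i).filter fun x => P i x).map (e i)) := by
  refine (Feas.flatMap (F := fun i x => if P i x then [x] else []) (e' := e) hlen
    ((PolyBdd.const _ 1).mono fun x => by split_ifs <;> simp) hL ?_).congr fun i => ?_
  · refine (hP.ite ((Feas.top _ _ _).cons (Feas.nil _ _)) (Feas.nil _ _)).congr fun x => ?_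
    split_ifs <;> rfl
  · congr 2
    induction L i with
    | nil => rfl
    | cons x l ih =>
      rw [List.flatMap_cons, ih, List.filter_cons]
      split_ifs <;> simp_all

open Classical in
/-- Remove repetitions from a list. -/
noncomputable def nubList {β : Type} (l : List β) : List β :=
  l.foldl (fun acc x => if x ∈ acc then acc else x :: acc) []

theorem nubList_spec {β : Type} (l : List β) :
    (nubList l).Nodup ∧ ∀ x, x ∈ nubList l ↔ x ∈ l := by
  classical
  have : ∀ (l acc : List β), acc.Nodup →
      (l.foldl (fun acc x => if x ∈ acc then acc else x :: acc) acc).Nodup ∧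
      ∀ x, x ∈ l.foldl (fun acc x => if x ∈ acc then acc else x :: acc) acc ↔ x ∈ l ∨ x ∈ acc := by
    intro l
    induction l with
    | nil => exact fun acc h => ⟨h, by simp⟩
    | cons y l ih =>
      intro acc hacc
      rw [List.foldl_cons]
      split_ifs with h
      · refine ⟨(ih _ hacc).1, fun x => ?_⟩
        rw [(ih _ hacc).2, List.mem_cons]
        constructor
        · tauto
        · rintro ((rfl | h') | h') <;> tauto
      · have hacc' : (y :: acc).Nodup := List.nodup_cons.2 ⟨h, hacc⟩
        refine ⟨(ih _ hacc').1, fun x => ?_⟩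
        rw [(ih _ hacc').2, List.mem_cons, List.mem_cons]
        tauto
  unfold nubList
  convert this l [] List.nodup_nil using 3
  simp

theorem Feas.nubList {β : ι → Type} {L : ∀ i, List (β i)} {e : ∀ i, β i → Data}
    (hlen : PolyBdd N fun i => (L i).length)
    (hL : Feas N a fun i => Data.ofList ((L i).map (e i)))
    (heq : Feas (ι := Σ i, β i × β i) (fun x => N x.1)
      (fun x => .cons (e x.1 x.2.1) (.cons (e x.1 x.2.2) (a x.1)))
      fun x => Data.ofProp (x.2.1 = x.2.2)) :
    Feas N a fun i => Data.ofList ((nubList (L i)).map (e i)) := by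
  classical
  unfold FillIn.nubList
  -- The length invariant is needed because testing membership in an arbitrary accumulator has no
  -- polynomial time bound.
  refine Feas.foldl_of_inv (σ := fun i => List (β i)) (eσ := fun i l => Data.ofList (l.map (e i)))
    (fun i l => l.length ≤ (L i).length) (fun i j => ?_) hlen hL (Feas.nil _ _) ?_
  · have : ∀ l acc : List (β i), (l.foldl (fun acc x => if x ∈ acc then acc else x :: acc)
        acc).length ≤ l.length + acc.length := by
      intro l
      induction l with
      | nil => simp
      | cons x l ih =>
        intro acc
        rw [List.foldl_cons, List.length_cons]
        refine (ih _).trans ?_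
        split_ifs
        · simp
        · simp; omega
    refine (this _ []).trans ?_
    simp
  · let κ := Σ i, {s : List (β i) // s.length ≤ (L i).length} × β i
    have hacc : Feas (ι := κ) (fun x => N x.1) (fun x => .cons (e x.1 x.2.2)
        (.cons (Data.ofList (x.2.1.1.map (e x.1))) (a x.1)))
        fun x => Data.ofList (x.2.1.1.map (e x.1)) := (Feas.refl _ _).tl.hd
    have hmem : Feas (ι := κ) (fun x => N x.1) (fun x => .cons (e x.1 x.2.2)
        (.cons (Data.ofList (x.2.1.1.map (e x.1))) (a x.1)))
        fun x => Data.ofProp (∃ y ∈ x.2.1.1, y = x.2.2) := by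
      refine Feas.exists_mem (e := fun x => e x.1)
        ((hlen.comap fun x : κ => x.1).mono fun x => x.2.1.2) hacc ?_
      exact ((Feas.refl _ _).hd.cons ((Feas.refl _ _).tl.hd.cons (Feas.refl _ _).tl.tl.tl)).trans
        (heq.comap fun x : Σ x : κ, β x.1 => ⟨x.1.1, x.2, x.1.2.2⟩)
    refine (hmem.ite hacc ((Feas.refl _ _).hd.cons hacc)).congr fun x => ?_
    simp only [exists_eq_right]
    split_ifs <;> rfl

end Lists

/-! ### Integer square roots of unary numbers -/

section Numbers

/-- One step of counting up to a perfect square: `r` is the root, `o = 2 r + 1`, and `q` is the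
distance to the next square. -/
def sqrtStep (x : ℕ × ℕ × ℕ) : ℕ × ℕ × ℕ :=
  if 0 < x.2.2 - 1 then (x.1, x.2.1, x.2.2 - 1) else (x.1 + 1, x.2.1 + 2, x.2.1 + 2)

/-- The gap from `(r+1)²` to `(r+2)²` is `2r + 3`, the old odd number plus 2, so the root is found
by counting without multiplication. -/
theorem sqrtStep_iterate (k : ℕ) : sqrtStep^[k] (0, 1, 1) =
    (Nat.sqrt k, 2 * Nat.sqrt k + 1, (Nat.sqrt k + 1) * (Nat.sqrt k + 1) - k) := by
  induction k with
  | zero => rfl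
  | succ k ih =>
    rw [Function.iterate_succ_apply', ih]
    have h1 := Nat.sqrt_le k
    have h2 := Nat.lt_succ_sqrt k
    simp only [Nat.succ_eq_add_one] at h2
    generalize hr : Nat.sqrt k = r at *
    simp only [sqrtStep]
    split_ifs with h
    · have : Nat.sqrt (k + 1) = r := (Nat.eq_sqrt.2 ⟨by omega, by omega⟩).symm
      rw [this, Nat.sub_sub]
    · have hk : k + 1 = (r + 1) * (r + 1) := by omega
      rw [hk, Nat.sqrt_eq]
      ext
      · rfl
      · simp; ring
      · simp only
        have : (r + 1 + 1) * (r + 1 + 1) = (r + 1) * (r + 1) + (2 * r + 1 + 2) := by ring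
        omega

variable {ι : Type} {N : ι → ℕ} {a : ι → Data} {m : ι → ℕ}

theorem Feas.sqrt (hm : PolyBdd N m) (h : Feas N a fun i => Data.ofNat (m i)) :
    Feas N a fun i => Data.ofNat (Nat.sqrt (m i)) := by
  refine (Feas.iterate_ofNat (σ := fun _ => ℕ × ℕ × ℕ)
    (eσ := fun _ x => .cons (Data.ofNat x.1) (.cons (Data.ofNat x.2.1) (Data.ofNat x.2.2)))
    (init := fun _ => (0, 1, 1)) (f := fun _ => sqrtStep) hm h ?_ ?_).hd.congr fun i => ?_
  · have h1 : Feas N a fun _ => Data.ofNat 1 := Feas.true N a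
    exact (Feas.nil N a).cons (h1.cons h1)
  · let e : (Σ _ : ι, ℕ × ℕ × ℕ) → Data := fun x => 
      .cons (Data.ofNat x.2.1) (.cons (Data.ofNat x.2.2.1) (Data.ofNat x.2.2.2))
    have hr : Feas (ι := Σ _ : ι, ℕ × ℕ × ℕ) (fun x => N x.1) (fun x => .cons (e x) (a x.1))
        fun x => Data.ofNat x.2.1 := (Feas.refl _ _).hd.hd
    have ho : Feas (ι := Σ _ : ι, ℕ × ℕ × ℕ) (fun x => N x.1) (fun x => .cons (e x) (a x.1))
        fun x => Data.ofNat x.2.2.1 := (Feas.refl _ _).hd.tl.hd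
    have hq : Feas (ι := Σ _ : ι, ℕ × ℕ × ℕ) (fun x => N x.1) (fun x => .cons (e x) (a x.1))
        fun x => Data.ofNat x.2.2.2 := (Feas.refl _ _).hd.tl.tl
    refine (Feas.ite (hq.pred.ne_nil.iff fun x => ofNat_ne_nil) (hr.cons (ho.cons hq.pred))
      (hr.succ.cons (ho.succ.succ.cons ho.succ.succ))).congr fun x => ?_
    unfold sqrtStep
    split_ifs <;> rfl
  · rw [sqrtStep_iterate]
    rfl

end Numbers

/-! ### The listing algorithm -/

section Algorithm

variable {ι : Type} {N : ι → ℕ} {a : ι → Data} {n : ι → ℕ} {G : ∀ i, SimpleGraph (Fin (n i))}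

/-- The vertex list is computed from the adjacency matrix. -/
theorem Feas.hasVerts (hn : PolyBdd N n) (hG : Feas N a fun i => Data.ofGraph (G i)) :
    HasVerts N a n := by
  refine ⟨hn, ?_⟩
  have hrows : Feas N a fun i => Data.ofList (((List.finRange (n i)).map fun u =>
      Data.ofList (List.ofFn fun v => Data.ofProp ((G i).Adj u v))).map id) :=
    hG.congr fun i => by rw [List.map_id, Data.ofGraph, List.ofFn_eq_map]
  -- Only the number of rows matters: a counter and a list are built together, giving the vertices
  -- in descending order.
  have hpair := Feas.iterate (β := fun _ => Data) (eβ := fun _ => id) (σ := fun _ => ℕ × List ℕ)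
    (eσ := fun _ x => .cons (Data.ofNat x.1) (Data.ofList (x.2.map Data.ofNat)))
    (init := fun _ => (0, [])) (f := fun _ x => (x.1 + 1, x.1 :: x.2))
    (hn.mono fun i => by simp) hrows ((Feas.nil _ _).cons (Feas.nil _ _)) ?_
  · have hiter : ∀ m, (fun x : ℕ × List ℕ => (x.1 + 1, x.1 :: x.2))^[m] (0, []) =
        (m, (List.range m).reverse) := by
      intro m
      induction m with
      | zero => rfl
      | succ m ih => rw [Function.iterate_succ_apply', ih, List.range_succ]; simp
    have hrev : Feas N a fun i =>
        Data.ofList ((List.range (n i)).reverse.map fun m => Data.ofNat m) :=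
      hpair.tl.congr fun i => by rw [hiter]; simp [Data.tl]
    refine (Feas.reverse (β := fun _ => ℕ) (L := fun i => (List.range (n i)).reverse)
      (e := fun _ m => Data.ofNat m) (hn.mono fun i => by simp) hrev).congr fun i => ?_
    rw [List.reverse_reverse, ← List.map_coe_finRange_eq_range, List.map_map]
    rfl
  · have hc := (Feas.top (ι := Σ _ : ι, ℕ × List ℕ) (fun x => N x.1) (fun x => .cons
      (Data.ofNat x.2.1) (Data.ofList (x.2.2.map Data.ofNat))) fun x => a x.1)
    exact hc.hd.succ.cons (hc.hd.cons hc.tl)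

theorem Feas.vertexSet {Ω : ∀ i, Finset (Fin (n i))} (hV : HasVerts N a n)
    (h : Feas (ι := Σ i, Fin (n i)) (fun x => N x.1) (fun x => .cons (Data.ofNat x.2) (a x.1))
      fun x => Data.ofProp (x.2 ∈ Ω x.1)) : Feas N a fun i => Data.ofVertexSet (Ω i) :=
  Feas.tab hV h

theorem Feas.mem_vertexSet {Ω : ∀ i, Finset (Fin (n i))} {v : ∀ i, Fin (n i)}
    (hV : HasVerts N a n) (h : Feas N a fun i => Data.ofVertexSet (Ω i))
    (hv : Feas N a fun i => Data.ofNat (v i)) : Feas N a fun i => Data.ofProp (v i ∈ Ω i) :=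
  Feas.get hV h hv

theorem Feas.vertexSet_eq {Ω Ω' : ∀ i, Finset (Fin (n i))} (hV : HasVerts N a n)
    (h : Feas N a fun i => Data.ofVertexSet (Ω i)) (h' : Feas N a fun i => Data.ofVertexSet (Ω' i)) :
    Feas N a fun i => Data.ofProp (Ω i = Ω' i) := by
  have h1 := Feas.mem_vertexSet hV.push (h.push hV) hV.var
  have h2 := Feas.mem_vertexSet hV.push (h'.push hV) hV.var
  refine (Feas.forall (R := fun i v => (v ∈ Ω i → v ∈ Ω' i) ∧ (v ∈ Ω' i → v ∈ Ω i)) hV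
    ((h1.imp h2).and (h2.imp h1))).iff fun i => ?_
  rw [Finset.ext_iff]
  exact forall_congr' fun v => iff_iff_implies_and_implies.symm

-- Expresses the number of missing ordered pairs as a list length, which can be computed in unary.
open Classical in
theorem sum_missing_eq_length {n : ℕ} (G : SimpleGraph (Fin n)) (Ω : Finset (Fin n)) :
    ∑ x ∈ Ω, (missing G Ω x).card = ((List.finRange n).flatMap fun x =>
      (List.finRange n).filter fun y => x ∈ Ω ∧ y ∈ Ω ∧ x ≠ y ∧ ¬ G.Adj x y).length := by
  rw [List.length_flatMap, ← Fin.sum_univ_def, ← Finset.sum_subset (Finset.subset_univ Ω)]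
  · refine Finset.sum_congr rfl fun x hx => ?_
    rw [← List.toFinset_card_of_nodup ((List.nodup_finRange n).filter _)]
    congr 1
    ext y
    simp [missing, hx]
  · intro x _ hx
    simp [hx]

theorem Feas.isVitalPMC {Ω : ∀ i, Finset (Fin (n i))} {k : ι → ℕ} (hk : PolyBdd N k)
    (hV : HasVerts N a n) (hK : Feas N a fun i => Data.ofNat (k i))
    (hG : Feas N a fun i => Data.ofGraph (G i)) (hΩ : Feas N a fun i => Data.ofVertexSet (Ω i)) :
    Feas N a fun i => Data.ofProp (IsVitalPMC (G i) (k i) (Ω i)) := by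
  classical
  have hlen : PolyBdd N fun i => (List.finRange (n i)).length := hV.bdd.mono fun i => by simp
  have hlen' : ∀ i x, ((List.finRange (n i)).filter fun y =>
      x ∈ Ω i ∧ y ∈ Ω i ∧ x ≠ y ∧ ¬ (G i).Adj x y).length ≤ n i := fun i x =>
    (List.length_filter_le _ _).trans (by simp)
  have hlist := Feas.flatMap (a := a) (β := fun i => Fin (n i)) (γ := fun i => Fin (n i))
    (L := fun i => List.finRange (n i)) (e := fun i v => Data.ofNat v)
    (e' := fun i v => Data.ofNat v) (F := fun i x => (List.finRange (n i)).filter fun y =>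
      x ∈ Ω i ∧ y ∈ Ω i ∧ x ≠ y ∧ ¬ (G i).Adj x y) hlen
    ((hV.bdd.comap fun x : Σ i, Fin (n i) => x.1).mono fun x => hlen' _ _) hV.feas ?_
  · have hcount := hlist.length ((hV.bdd.mul hV.bdd).mono fun i => ?_)
    · have hle := hcount.le (hk.add hk) (hK.add hk hK)
      have hpmc := Feas.pmcCond (S := fun i => (Ω i : Set (Fin (n i)))) hV hG hΩ
      refine (hpmc.and hle).iff fun i => ?_
      rw [isVitalPMC_iff, sum_missing_eq_length, two_mul]
    · rw [List.length_flatMap]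
      refine (List.sum_le_card_nsmul _ (n i) fun x hx => ?_).trans (by simp)
      obtain ⟨v, -, rfl⟩ := List.mem_map.1 hx
      exact hlen' i v
  · refine Feas.filter (β := fun x : Σ i, Fin (n i) => Fin (n x.1)) (e := fun _ v => Data.ofNat v)
      (P := fun x y => x.2 ∈ Ω x.1 ∧ y ∈ Ω x.1 ∧ x.2 ≠ y ∧ ¬ (G x.1).Adj x.2 y) (hlen.comap _)
      hV.push.feas ?_
    have hV₂ := hV.push.push
    have hx := hV.var.push hV.push
    have hy := hV.push.var
    have hΩ₂ := (hΩ.push hV).push hV.push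
    exact (Feas.mem_vertexSet hV₂ hΩ₂ hx).and ((Feas.mem_vertexSet hV₂ hΩ₂ hy).and
      ((Feas.eq hV₂ hx hy).not.and (Feas.adj hV₂ ((hG.push hV).push hV.push) hx hy).not))

section Candidates

variable {Z : ∀ i, Finset (Fin (n i))} {z b c : ∀ i, Fin (n i)}

theorem Feas.completion (hV : HasVerts N a n) (hG : Feas N a fun i => Data.ofGraph (G i))
    (hZ : Feas N a fun i => Data.ofVertexSet (Z i)) (hz : Feas N a fun i => Data.ofNat (z i)) :
    Feas N a fun i => Data.ofGraph (FillIn.lbClosure (FillIn.isolate (G i) {x | x ∈ Z i ∧ x ≠ z i})) :=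
  Feas.lbClosure hV (Feas.isolate hV hG (Feas.ofSet (S := fun i => {x | x ∈ Z i ∧ x ≠ z i}) hV
    ((Feas.mem_vertexSet hV.push (hZ.push hV) hV.var).and
      (Feas.eq hV.push hV.var (hz.push hV)).not)))

theorem Feas.sepCandidate (hV : HasVerts N a n) (hG : Feas N a fun i => Data.ofGraph (G i))
    (hZ : Feas N a fun i => Data.ofVertexSet (Z i)) (hz : Feas N a fun i => Data.ofNat (z i))
    (hb : Feas N a fun i => Data.ofNat (b i)) (hc : Feas N a fun i => Data.ofNat (c i)) :
    Feas N a fun i => Data.ofVertexSet (FillIn.sepCandidate (G i) (Z i) (z i) (b i) (c i)) := by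
  have hH := (Feas.completion hV hG hZ hz).push hV
  refine Feas.vertexSet hV (((Feas.mem_vertexSet hV.push (hZ.push hV) hV.var).or
    ((Feas.adj hV.push hH (hb.push hV) hV.var).and (Feas.adj hV.push hH (hc.push hV) hV.var))).iff
      fun x => ?_)
  simp [FillIn.sepCandidate]

theorem Feas.cliqueCandidate (hV : HasVerts N a n) (hG : Feas N a fun i => Data.ofGraph (G i))
    (hZ : Feas N a fun i => Data.ofVertexSet (Z i)) (hz : Feas N a fun i => Data.ofNat (z i))
    (hb : Feas N a fun i => Data.ofNat (b i)) (hc : Feas N a fun i => Data.ofNat (c i)) :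
    Feas N a fun i => Data.ofVertexSet (FillIn.cliqueCandidate (G i) (Z i) (z i) (b i) (c i)) := by
  have hV₁ := hV.push
  have hV₂ := hV₁.push
  have hH := ((Feas.completion hV hG hZ hz).push hV).push hV₁
  have hu := hV.var.push hV₁
  have hx := hV₁.var
  let H := fun i => FillIn.lbClosure (FillIn.isolate (G i) {x | x ∈ Z i ∧ x ≠ z i})
  have hall : Feas (ι := Σ i, Fin (n i)) (fun x => N x.1)
      (fun x => .cons (Data.ofNat x.2) (a x.1)) fun u => Data.ofProp (∀ x, (x = z u.1 ∨
        ((H u.1).Adj (b u.1) x ∧ (H u.1).Adj (c u.1) x)) → x = u.2 ∨ (H u.1).Adj u.2 x) :=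
    Feas.forall hV₁ (((Feas.eq hV₂ hx ((hz.push hV).push hV₁)).or
      ((Feas.adj hV₂ hH ((hb.push hV).push hV₁) hx).and
        (Feas.adj hV₂ hH ((hc.push hV).push hV₁) hx))).imp
      ((Feas.eq hV₂ hx hu).or (Feas.adj hV₂ hH hu hx)))
  refine Feas.vertexSet hV (((Feas.mem_vertexSet hV₁ (hZ.push hV) hV.var).or hall).iff fun x => ?_)
  simp [FillIn.cliqueCandidate, H]

theorem Feas.nbrCandidate (hV : HasVerts N a n) (hG : Feas N a fun i => Data.ofGraph (G i))
    (hZ : Feas N a fun i => Data.ofVertexSet (Z i)) (hz : Feas N a fun i => Data.ofNat (z i))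
    (hb : Feas N a fun i => Data.ofNat (b i)) :
    Feas N a fun i => Data.ofVertexSet (FillIn.nbrCandidate (G i) (Z i) (z i) (b i)) := by
  have hV₁ := hV.push
  have hS := Feas.ofSet (S := fun i => {x | x = b i ∨ (G i).Adj (b i) x ∨ (x ∈ Z i ∧ x ≠ z i)}) hV
    ((Feas.eq hV₁ hV.var (hb.push hV)).or
    ((Feas.adj hV₁ (hG.push hV) (hb.push hV) hV.var).or
      ((Feas.mem_vertexSet hV₁ (hZ.push hV) hV.var).and
        (Feas.eq hV₁ hV.var (hz.push hV)).not)))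
  refine Feas.vertexSet hV (((Feas.mem_vertexSet hV₁ (hZ.push hV) hV.var).or
    ((Feas.conn hV₁ (hG.push hV) (hS.push hV) (hz.push hV) hV.var).not.and
      (Feas.sees hV₁ (hG.push hV) (hS.push hV) (hz.push hV) hV.var))).iff fun x => ?_)
  simp [FillIn.nbrCandidate]

end Candidates

end Algorithm

/-! ### Enumeration of small sets and candidates -/

section Algorithm

variable {ι : Type} {N : ι → ℕ} {a : ι → Data} {n : ι → ℕ} {G : ∀ i, SimpleGraph (Fin (n i))}

theorem PolyBdd.length_flatMap {β γ : ι → Type} {L : ∀ i, List (β i)} {F : ∀ i, β i → List (γ i)}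
    (hL : PolyBdd N fun i => (L i).length)
    (hF : PolyBdd (ι := Σ i, β i) (fun x => N x.1) fun x => (F x.1 x.2).length) :
    PolyBdd N fun i => ((L i).flatMap (F i)).length := by
  obtain ⟨c, hc⟩ := hF
  refine (hL.mul (PolyBdd.pow_self N c)).mono fun i => ?_
  rw [List.length_flatMap]
  refine (List.sum_le_card_nsmul _ ((N i + 2) ^ c) fun x hx => ?_).trans (by simp)
  obtain ⟨v, -, rfl⟩ := List.mem_map.1 hx
  exact hc ⟨i, v⟩

/-- Extend each set of the list by at most one vertex. -/
def extendSets {n : ℕ} (L : List (Finset (Fin n))) : List (Finset (Fin n)) :=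
  L.flatMap fun Z => Z :: (List.finRange n).map fun v => insert v Z

/-- A list of the vertex sets with at most `s` elements. -/
def smallSets (n s : ℕ) : List (Finset (Fin n)) := extendSets^[s] [∅]

/-- Each set yields itself and one extension per vertex. Repetitions are kept, so the count is
exact. -/
theorem length_extendSets_iterate {n : ℕ} (s : ℕ) :
    (extendSets^[s] [(∅ : Finset (Fin n))]).length = (n + 1) ^ s := by
  induction s with
  | zero => rfl
  | succ s ih =>
    rw [Function.iterate_succ_apply', extendSets, List.length_flatMap]
    simp [ih, pow_succ]

theorem mem_smallSets {n s : ℕ} {Z : Finset (Fin n)} (h : Z.card ≤ s) : Z ∈ smallSets n s := by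
  induction s generalizing Z with
  | zero => simpa [smallSets] using h
  | succ s ih =>
    rw [smallSets, Function.iterate_succ_apply', extendSets, List.mem_flatMap]
    rcases Z.eq_empty_or_nonempty with rfl | ⟨v, hv⟩
    · exact ⟨∅, ih (by simp), by simp⟩
    · refine ⟨Z.erase v, ih (by rw [Finset.card_erase_of_mem hv]; omega), ?_⟩
      refine List.mem_cons_of_mem _ (List.mem_map.2 ⟨v, List.mem_finRange v, ?_⟩)
      exact Finset.insert_erase hv

theorem Feas.extendSets {L : ∀ i, List (Finset (Fin (n i)))} (hV : HasVerts N a n)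
    (hlen : PolyBdd N fun i => (L i).length)
    (hL : Feas N a fun i => Data.ofList ((L i).map Data.ofVertexSet)) :
    Feas N a fun i => Data.ofList ((extendSets (L i)).map Data.ofVertexSet) := by
  refine Feas.flatMap (β := fun i => Finset (Fin (n i))) (γ := fun i => Finset (Fin (n i)))
    (e := fun _ => Data.ofVertexSet) (e' := fun _ => Data.ofVertexSet)
    (F := fun i (Z : Finset (Fin (n i))) => Z :: (List.finRange (n i)).map fun v => insert v Z) hlen
    ((hV.bdd.add (PolyBdd.const N 1)).comap _ |>.mono fun x => by simp) hL ?_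
  have hV₁ := hV.up (β := fun i => Finset (Fin (n i))) fun x => Data.ofVertexSet x.2
  have hZ := Feas.top (ι := Σ i, Finset (Fin (n i))) (fun x => N x.1)
    (fun x => Data.ofVertexSet x.2) fun x => a x.1
  refine hZ.cons (Feas.map (β := fun x : Σ i, Finset (Fin (n i)) => Fin (n x.1))
    (γ := fun x => Finset (Fin (n x.1))) (e := fun _ v => Data.ofNat v)
    (e' := fun _ => Data.ofVertexSet)
    (F := fun (x : Σ i, Finset (Fin (n i))) (v : Fin (n x.1)) => insert v x.2) (hV₁.bdd.mono fun x => by simp) hV₁.feas ?_)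
  have hV₂ := hV₁.push
  refine Feas.vertexSet hV₂ (((Feas.eq hV₂.push hV₂.var (hV₁.var.push hV₂)).or
    (Feas.mem_vertexSet hV₂.push ((hZ.push hV₁).push hV₂) hV₂.var)).iff fun x => ?_)
  rw [Finset.mem_insert]

theorem Feas.smallSets {s : ι → ℕ} (hV : HasVerts N a n) (hs : Feas N a fun i => Data.ofNat (s i))
    (hsb : PolyBdd N s) (hb : PolyBdd N fun i => (n i + 1) ^ s i) :
    Feas N a fun i => Data.ofList ((smallSets (n i) (s i)).map Data.ofVertexSet) := by
  have hfold : ∀ {m j : ℕ} {L : List (Finset (Fin m))},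
      (List.replicate j ()).foldl (fun L _ => FillIn.extendSets L) L =
        FillIn.extendSets^[j] L := by
    intro m j L
    induction j generalizing L with
    | zero => rfl
    | succ j ih => rw [List.replicate_succ, List.foldl_cons, ih, Function.iterate_succ_apply]
  -- One extension is polynomial only in the length of the current list; the invariant bounds that
  -- length by the final one.
  have h := Feas.foldl_of_inv (N := N) (a := a) (β := fun _ => Unit)
    (L := fun i => List.replicate (s i) ()) (eβ := fun _ _ => .nil)
    (σ := fun i => List (Finset (Fin (n i)))) (eσ := fun _ L => Data.ofList (L.map Data.ofVertexSet))
    (init := fun _ => [∅]) (step := fun _ L _ => FillIn.extendSets L)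
    (fun i L => L.length ≤ (n i + 1) ^ s i) ?_ (hsb.mono fun i => by simp) ?_ ?_ ?_
  · exact h.congr fun i => by rw [hfold]; rfl
  · intro i j
    rw [List.take_replicate, hfold, length_extendSets_iterate]
    exact Nat.pow_le_pow_right (by omega) (min_le_right _ _)
  · exact hs.congr fun i => by rw [List.map_replicate]; rfl
  · refine Feas.cons (Feas.vertexSet hV ((Feas.nil _ _).congr fun x => ?_)) (Feas.nil _ _)
    rw [ofProp_of_false (Finset.notMem_empty _)]
  · let κ := Σ i, {L : List (Finset (Fin (n i))) // L.length ≤ (n i + 1) ^ s i} × Unit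
    refine Feas.extendSets (ι := κ) (n := fun x => n x.1) (L := fun x => x.2.1.1) ⟨hV.bdd.comap _, ?_⟩
      ((hb.comap fun x : κ => x.1).mono fun x => x.2.1.2) (Feas.refl _ _).tl.hd
    exact (hV.feas.up₁ (β := fun i => {L : List (Finset (Fin (n i))) //
      L.length ≤ (n i + 1) ^ s i} × Unit) fun x => Data.ofList (x.2.1.1.map Data.ofVertexSet)).up
        (g := id) (fun _ => rfl) fun _ => rfl

/-- The candidates for vital potential maximal cliques obtained from sets `Z` of at most `s`
vertices. -/
noncomputable def candidates {n : ℕ} (G : SimpleGraph (Fin n)) (s : ℕ) : List (Finset (Fin n)) :=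
  Finset.univ :: (smallSets n s).flatMap fun Z => (List.finRange n).flatMap fun z =>
    (List.finRange n).flatMap fun b => (List.finRange n).flatMap fun c =>
      [sepCandidate G Z z b c, cliqueCandidate G Z z b c, nbrCandidate G Z z b]

theorem IsVitalPMC.mem_candidates {n k s : ℕ} {G : SimpleGraph (Fin n)} {Ω : Finset (Fin n)}
    (hG : NonReducible G k) (hΩ : IsVitalPMC G k Ω) (hs : 5 * √(k : ℝ) ≤ s) :
    Ω ∈ candidates G s := by
  rcases hΩ.exists_candidate hG with h | ⟨Z, z, b, c, hZ, h⟩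
  · exact h ▸ List.mem_cons_self
  · refine List.mem_cons_of_mem _ (List.mem_flatMap.2 ⟨Z, mem_smallSets ?_, ?_⟩)
    · exact_mod_cast hZ.trans hs
    · simp only [List.mem_flatMap, List.mem_finRange, true_and, List.mem_cons, List.not_mem_nil,
        or_false]
      exact ⟨z, b, c, h⟩

theorem Feas.flatMap_verts {γ : ι → Type} {F : ∀ i, Fin (n i) → List (γ i)}
    {e : ∀ i, γ i → Data} (hV : HasVerts N a n)
    (hlen : PolyBdd (ι := Σ i, Fin (n i)) (fun x => N x.1) fun x => (F x.1 x.2).length)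
    (hF : Feas (ι := Σ i, Fin (n i)) (fun x => N x.1) (fun x => .cons (Data.ofNat x.2) (a x.1))
      fun x => Data.ofList ((F x.1 x.2).map (e x.1))) :
    (PolyBdd N fun i => ((List.finRange (n i)).flatMap (F i)).length) ∧
    Feas N a fun i => Data.ofList (((List.finRange (n i)).flatMap (F i)).map (e i)) := by
  have h : PolyBdd N fun i => (List.finRange (n i)).length := hV.bdd.mono fun i => by simp
  exact ⟨h.length_flatMap hlen, Feas.flatMap h hlen hV.feas hF⟩

theorem Feas.candidates {s : ι → ℕ} (hV : HasVerts N a n)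
    (hG : Feas N a fun i => Data.ofGraph (G i)) (hs : Feas N a fun i => Data.ofNat (s i))
    (hsb : PolyBdd N s) (hb : PolyBdd N fun i => (n i + 1) ^ s i) :
    (PolyBdd N fun i => (candidates (G i) (s i)).length) ∧
    Feas N a fun i => Data.ofList ((candidates (G i) (s i)).map Data.ofVertexSet) := by
  let κ₁ := Σ i, Finset (Fin (n i))
  let κ₂ := Σ x : κ₁, Fin (n x.1)
  let κ₃ := Σ x : κ₂, Fin (n x.1.1)
  have hV₁ := hV.up (β := fun i => Finset (Fin (n i))) fun x => Data.ofVertexSet x.2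
  have hZ := Feas.top (ι := Σ i, Finset (Fin (n i))) (fun x => N x.1)
    (fun x => Data.ofVertexSet x.2) fun x => a x.1
  have hG₁ := hG.up₁ (β := fun i => Finset (Fin (n i))) fun x => Data.ofVertexSet x.2
  have hV₂ := hV₁.push
  have hV₃ := hV₂.push
  have hV₄ := hV₃.push
  have hZ₄ := ((hZ.push hV₁).push hV₂).push hV₃
  have hG₄ := ((hG₁.push hV₁).push hV₂).push hV₃
  have hz := (hV₁.var.push hV₂).push hV₃
  have hb₄ := hV₂.var.push hV₃
  have hc := hV₃.var
  have h3 := (Feas.sepCandidate hV₄ hG₄ hZ₄ hz hb₄ hc).cons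
    ((Feas.cliqueCandidate hV₄ hG₄ hZ₄ hz hb₄ hc).cons
      ((Feas.nbrCandidate hV₄ hG₄ hZ₄ hz hb₄).cons (Feas.nil _ _)))
  have hc := Feas.flatMap_verts (γ := fun x : κ₃ => Finset (Fin (n x.1.1.1)))
    (F := fun (x : κ₃) c => [FillIn.sepCandidate (G x.1.1.1) x.1.1.2 x.1.2 x.2 c,
      FillIn.cliqueCandidate (G x.1.1.1) x.1.1.2 x.1.2 x.2 c,
      FillIn.nbrCandidate (G x.1.1.1) x.1.1.2 x.1.2 x.2]) (e := fun _ => Data.ofVertexSet)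
    hV₃ (PolyBdd.const _ 3) h3
  have hb' := Feas.flatMap_verts (γ := fun x : κ₂ => Finset (Fin (n x.1.1)))
    (F := fun (x : κ₂) b => (List.finRange (n x.1.1)).flatMap fun c =>
      [FillIn.sepCandidate (G x.1.1) x.1.2 x.2 b c, FillIn.cliqueCandidate (G x.1.1) x.1.2 x.2 b c,
        FillIn.nbrCandidate (G x.1.1) x.1.2 x.2 b]) (e := fun _ => Data.ofVertexSet) hV₂ hc.1 hc.2
  have hz' := Feas.flatMap_verts (γ := fun x : κ₁ => Finset (Fin (n x.1)))
    (F := fun (x : κ₁) z => (List.finRange (n x.1)).flatMap fun b => (List.finRange (n x.1)).flatMap fun c =>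
      [FillIn.sepCandidate (G x.1) x.2 z b c, FillIn.cliqueCandidate (G x.1) x.2 z b c,
        FillIn.nbrCandidate (G x.1) x.2 z b]) (e := fun _ => Data.ofVertexSet) hV₁ hb'.1 hb'.2
  have hlen : PolyBdd N fun i => (FillIn.smallSets (n i) (s i)).length :=
    hb.mono fun i => (length_extendSets_iterate _).le
  have huniv : Feas N a fun i => Data.ofVertexSet (Finset.univ : Finset (Fin (n i))) :=
    Feas.vertexSet hV ((Feas.true _ _).congr fun x => (ofProp_of_true (Finset.mem_univ _)).symm)
  refine ⟨?_, huniv.cons (Feas.flatMap (β := fun i => Finset (Fin (n i)))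
    (γ := fun i => Finset (Fin (n i))) (e := fun _ => Data.ofVertexSet)
    (e' := fun _ => Data.ofVertexSet) hlen hz'.1 (Feas.smallSets hV hs hsb hb) hz'.2)⟩
  exact ((hlen.length_flatMap hz'.1).add (PolyBdd.const N 1)).mono fun i => le_rfl

end Algorithm

/-! ### Non-reducible instances, the output list and its running time -/

/-- A non-reducible instance. -/
structure Instance where
  n : ℕ
  k : ℕ
  G : SimpleGraph (Fin n)
  nonReducible : NonReducible G k

namespace Instance

/-- The size parameter: running times are polynomial in it. -/
def size (i : Instance) : ℕ := max i.n 2 ^ (Nat.sqrt i.k + 1)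

open Classical in
/-- The list of the vital potential maximal cliques. -/
noncomputable def output (i : Instance) : List (Finset (Fin i.n)) :=
  nubList ((candidates i.G (5 * (Nat.sqrt i.k + 1))).filter fun Ω => IsVitalPMC i.G i.k Ω)

/-- Filtering gives soundness for any graph; completeness uses non-reducibility, with `5(⌊√k⌋ + 1)`
as an integer upper bound for `5√k`. -/
theorem mem_output (i : Instance) (Ω : Finset (Fin i.n)) :
    Ω ∈ i.output ↔ IsVitalPMC i.G i.k Ω := by
  rw [output, (nubList_spec _).2, List.mem_filter]
  simp only [decide_eq_true_eq, and_iff_right_iff_imp]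
  refine fun h => h.mem_candidates i.nonReducible ?_
  push_cast
  have := Real.real_sqrt_le_nat_sqrt_succ (a := i.k)
  linarith

theorem n_bdd : PolyBdd size n := by
  refine ⟨1, fun i => ?_⟩
  have h : max i.n 2 ≤ size i := Nat.le_self_pow (by omega) _
  have := le_max_left i.n 2
  rw [pow_one]
  omega

/-- Follows from `k < (⌊√k⌋ + 1)²` and `⌊√k⌋ + 1 < 2^(⌊√k⌋ + 1)`; the base `max n 2` keeps this
valid when `n < 2`. -/
theorem k_bdd : PolyBdd size k := by
  refine ⟨2, fun i => ?_⟩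
  have h1 : Nat.sqrt i.k + 1 ≤ size i + 2 := by
    have h2 : Nat.sqrt i.k + 1 < 2 ^ (Nat.sqrt i.k + 1) := Nat.lt_two_pow_self
    have h3 : 2 ^ (Nat.sqrt i.k + 1) ≤ size i := Nat.pow_le_pow_left (le_max_right _ _) _
    omega
  have h4 := Nat.lt_succ_sqrt i.k
  calc i.k ≤ (Nat.sqrt i.k + 1) * (Nat.sqrt i.k + 1) := h4.le
    _ ≤ (size i + 2) * (size i + 2) := Nat.mul_le_mul h1 h1
    _ = _ := by ring

/-- The exponent 10 is 5 from the bound on `Z`, doubled by `n + 1 ≤ (max n 2)²`. -/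
theorem sets_bdd : PolyBdd size fun i => (i.n + 1) ^ (5 * (Nat.sqrt i.k + 1)) := by
  refine ⟨10, fun i => ?_⟩
  have h1 : i.n + 1 ≤ max i.n 2 ^ 2 := by
    have := le_max_left i.n 2
    have := le_max_right i.n 2
    nlinarith
  calc (i.n + 1) ^ (5 * (Nat.sqrt i.k + 1)) ≤ (max i.n 2 ^ 2) ^ (5 * (Nat.sqrt i.k + 1)) :=
        Nat.pow_le_pow_left h1 _
    _ = size i ^ 10 := by rw [size, ← pow_mul, ← pow_mul]; congr 1; ring
    _ ≤ _ := Nat.pow_le_pow_left (by omega) _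

theorem feas_output : Feas size (fun i => Data.cons (Data.ofNat i.k) (Data.ofGraph i.G))
    fun i => Data.ofList (i.output.map Data.ofVertexSet) := by
  classical
  set a : Instance → Data := fun i => Data.cons (Data.ofNat i.k) (Data.ofGraph i.G)
  have hK : Feas size a fun i => Data.ofNat i.k := (Feas.refl _ _).hd
  have hG : Feas size a fun i => Data.ofGraph i.G := (Feas.refl _ _).tl
  have hV := hG.hasVerts n_bdd
  have hr := (hK.sqrt k_bdd).succ
  have hrb : PolyBdd size fun i => Nat.sqrt i.k + 1 :=
    (k_bdd.mono fun i => Nat.sqrt_le_self _).add (PolyBdd.const _ 1)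
  have hs : Feas size a fun i => Data.ofNat (5 * (Nat.sqrt i.k + 1)) :=
    (hr.add hrb (hr.add hrb (hr.add hrb (hr.add hrb hr)))).congr fun i => by congr 1; ring
  obtain ⟨hlen, hcand⟩ := Feas.candidates hV hG hs
    (((PolyBdd.const _ 5).mul hrb).mono fun i => le_rfl) sets_bdd
  refine Feas.nubList (β := fun i : Instance => Finset (Fin i.n)) (e := fun _ => Data.ofVertexSet)
    (hlen.mono fun i => List.length_filter_le _ _) (Feas.filter (β := fun i : Instance => Finset (Fin i.n))
      (e := fun _ => Data.ofVertexSet) (P := fun (i : Instance) Ω => IsVitalPMC i.G i.k Ω) hlen hcand ?_) ?_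
  · have hΩ := Feas.top (ι := Σ i : Instance, Finset (Fin i.n)) (fun x => size x.1)
      (fun x => Data.ofVertexSet x.2) fun x => a x.1
    exact Feas.isVitalPMC (k_bdd.comap _) (hV.up _) (hK.up₁ _) (hG.up₁ _) hΩ
  · let κ := Σ i : Instance, Finset (Fin i.n) × Finset (Fin i.n)
    have hV₂ : HasVerts (ι := κ) (fun x => size x.1) (fun x => .cons (Data.ofVertexSet x.2.1)
        (.cons (Data.ofVertexSet x.2.2) (a x.1))) fun x => x.1.n :=
      ⟨n_bdd.comap _, (hV.feas.up₁ (β := fun i => Finset (Fin i.n) × Finset (Fin i.n))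
        fun x => Data.ofVertexSet x.2.2).up (g := id) (fun _ => rfl) fun _ => rfl⟩
    exact Feas.vertexSet_eq hV₂ (Feas.refl _ _).hd (Feas.refl _ _).tl.hd

/-- The factor 4 is a 2 from `size + 2 ≤ size²` and a 2 from `⌊√k⌋ + 1 ≤ 2 max(1, √k)`. -/
theorem time_bound (i : Instance) (c : ℕ) : (((i.size + 2) ^ c : ℕ) : ℝ) ≤
    ((max i.n 2 : ℕ) : ℝ) ^ (((4 * c : ℕ) : ℝ) * max 1 (√(i.k : ℝ))) := by
  have h2 : 2 ≤ size i :=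
    (le_max_right i.n 2).trans (Nat.le_self_pow (by omega) _)
  have h3 : (size i + 2) ^ c ≤ max i.n 2 ^ ((Nat.sqrt i.k + 1) * (2 * c)) := by
    calc (size i + 2) ^ c ≤ (size i ^ 2) ^ c := Nat.pow_le_pow_left (by nlinarith) _
      _ = _ := by rw [size, ← pow_mul, ← pow_mul]
  have hbase : (1 : ℝ) ≤ ((max i.n 2 : ℕ) : ℝ) := by
    exact_mod_cast (by omega : 1 ≤ max i.n 2)
  refine (Nat.cast_le.2 h3).trans ?_
  rw [Nat.cast_pow, ← Real.rpow_natCast]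
  refine Real.rpow_le_rpow_of_exponent_le hbase ?_
  push_cast
  have h4 : (Nat.sqrt i.k : ℝ) ≤ √(i.k : ℝ) := Real.nat_sqrt_le_real_sqrt
  have h5 := le_max_left (1 : ℝ) √(i.k : ℝ)
  have h6 := le_max_right (1 : ℝ) √(i.k : ℝ)
  have h7 : (0 : ℝ) ≤ c := Nat.cast_nonneg c
  have h8 : (Nat.sqrt i.k : ℝ) + 1 ≤ 2 * max 1 √(i.k : ℝ) := by linarith
  nlinarith

end Instance

end FillIn

/-! ### The two parts of the lemma assembled -/

theorem mainTheorem5 :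
    (∃ (p : FillIn.Prog) (c : ℕ), ∀ (n k : ℕ) (G : SimpleGraph (Fin n)),
      FillIn.NonReducible G k →
        ∃ (t : ℕ) (L : List (Finset (Fin n))),
          FillIn.Outputs p G k t L ∧
          L.Nodup ∧
          (∀ Ω : Finset (Fin n), Ω ∈ L ↔ FillIn.IsVitalPMC G k Ω) ∧
          (t : ℝ) ≤ ((max n 2 : ℕ) : ℝ) ^ ((c : ℝ) * max 1 (√(k : ℝ)))) ∧
    (∀ (V : Type*) [Fintype V] (G : SimpleGraph V) (k : ℕ) (Ω : Finset V),
      FillIn.NonReducible G k → FillIn.IsVitalPMC G k Ω →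
      5 * √(k : ℝ) + 3 ≤ (Ω.card : ℝ) → ¬ FillIn.IsQuasiClique G k Ω →
        ∃ w : V, w ∉ Ω ∧
          (((Ω : Set V) \ G.neighborSet w).ncard : ℝ) ≤ 5 * √(k : ℝ) + 2 ∧
          FillIn.IsQuasiClique (FillIn.completeOn G (G.neighborSet w)) k Ω) := by
  constructor
  · obtain ⟨c, hc⟩ := FillIn.Instance.feas_output
    -- Input and output live in variable 0, so the base of the workspace is 0.
    obtain ⟨p, hp⟩ := hc 0
    refine ⟨p, 4 * c, fun n k G hG => ?_⟩
    let i : FillIn.Instance := ⟨n, k, G, hG⟩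
    obtain ⟨t, s, hexec, ht, hs, -⟩ := hp i (FillIn.inputStore G k) (Function.update_self _ _ _)
    exact ⟨t, i.output, ⟨s, hexec, hs⟩, (FillIn.nubList_spec _).1, i.mem_output,
      (Nat.cast_le.2 ht).trans (i.time_bound c)⟩
  · intro V _ G k Ω hG hΩ _ hq
    exact hΩ.exists_isQuasiClique_completeOn hG hq
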